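/- Let $k$ be a field with algebraic closure $\bar k$, and let $C=V(F)\subset\mathbb P^2$ be a reduced plane curve given by a squarefree homogeneous polynomial $F\in k[X_0,X_1,X_2]$ of degree $f$. Let $P$ be a singular point of $C$ defined over $k$, let $\varphi(x,y)\in k[x,y]$ be a local equation of $C$ in affine coordinates centred at $P$, and write $\varphi=\sum_i \varphi_i$ with $\varphi_i$ homogeneous of degree $i$. The singularity $P$ is called \emph{admissible} if (for a suitable such $\varphi$) it is of one of two types: (a) type $R_m$, $m\ge 2$: $\varphi_i=0$ for $i<m$, and $\varphi_m$ is a product of $m$ pairwise non-proportional linear forms over $\bar k$; (b) type $D_m$: $\varphi_0=\varphi_1=0$, $\varphi_2=L^2$ for a nonzero linear form $L$ over $k$, $L^2\mid \varphi_i$ for $2\le i\le m-1$, and $L\nmid \varphi_m$. The curve $C$ has \emph{only admissible singularities} if every singular point of $C$ over $\bar k$ is defined over $k$ and is admissible. For a point $P$ of $C_{\bar k}$ let $\delta(P)=\dim_{\bar k}\widetilde{\mathcal O}_{P}/\mathcal O_{P}$, where $\mathcal O_P$ is the local ring of $C_{\bar k}$ at $P$ and $\widetilde{\mathcal O}_P$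 its integral closure in its total ring of fractions. Assume $\delta=\sum_P\delta(P)$ is finite, and let $g=\binom{f-1}{2}-\delta$ be the genus of the normalization of $C$. Suppose that $C$ has only admissible singularities and that one of the following holds: $f\le 7$ and $g\ge 4$; or $f=8$ and $g\ge 7$; or $f=9$ and $g\ge 11$. If $C$ is reducible over $\bar k$, i.e. $F=HK$ with forms $H,K\in\bar k[X_0,X_1,X_2]$ of positive degree, then $C$ contains a line defined over $k$ or a conic defined over $k$ that is irreducible over $\bar k$: there is a form $G\in k[X_0,X_1,X_2]$ dividing $F$ which is either nonzero of degree $1$, or of degree $2$ and irreducible over $\bar k$. -/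

import Mathlib

open scoped LinearAlgebra.Projectivization

namespace PlaneCurve

noncomputable section

/-- The equation `F(v + x u + y w) ∈ R[x, y]` of the plane curve `V(F)` in the affine chart
attached to the frame `(v, u, w)`; the origin of the chart is the point `v`. -/
def chartEquation {R : Type*} [CommRing R] (F : MvPolynomial (Fin 3) R) (v u w : Fin 3 → R) :
    MvPolynomial (Fin 2) R :=
  MvPolynomial.aeval
    (fun i : Fin 3 => MvPolynomial.C (v i) + MvPolynomial.C (u i) * MvPolynomial.X (0 : Fin 2)
      + MvPolynomial.C (w i) * MvPolynomial.X (1 : Fin 2)) F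

/-- `f` is a local equation of `V(F)` in affine coordinates in which the point with homogeneous
coordinates `v` is the origin. -/
def IsLocalEquation {k : Type*} [Field k] (F : MvPolynomial (Fin 3) k) (v : Fin 3 → k)
    (f : MvPolynomial (Fin 2) k) : Prop :=
  ∃ u w : Fin 3 → k, LinearIndependent k ![v, u, w] ∧
    ∃ c : k, c ≠ 0 ∧ f = MvPolynomial.C c * chartEquation F v u w

/-- Linear form in two variables, not zero. -/
def IsLinearForm {k : Type*} [Field k] (L : MvPolynomial (Fin 2) k) : Prop :=
  L.IsHomogeneous 1 ∧ L ≠ 0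

/-- Type `R_m`: the homogeneous parts of degree less than `m` vanish, and the part of degree `m`
is a product of `m` distinct (pairwise non-proportional) linear forms over the algebraic
closure. -/
def IsRegularMultiplePoint {k : Type*} [Field k] (m : ℕ) (f : MvPolynomial (Fin 2) k) : Prop :=
  2 ≤ m ∧ (∀ i < m, MvPolynomial.homogeneousComponent i f = 0) ∧
    ∃ l : Fin m → MvPolynomial (Fin 2) (AlgebraicClosure k),
      (∀ j, IsLinearForm (l j)) ∧ (∀ i j, i ≠ j → ¬ Associated (l i) (l j)) ∧
      MvPolynomial.map (algebraMap k (AlgebraicClosure k)) (MvPolynomial.homogeneousComponent m f)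
        = ∏ j, l j

/-- Type `D_m`: `f₀ = f₁ = 0`, `f₂ = L²` for a linear form `L` over `k`, `L² ∣ f_i` for
`2 ≤ i ≤ m - 1`, and `L ∤ f_m`. (These conditions force `3 ≤ m`.) -/
def IsDoublePointOfIndex {k : Type*} [Field k] (m : ℕ) (f : MvPolynomial (Fin 2) k) : Prop :=
  MvPolynomial.homogeneousComponent 0 f = 0 ∧ MvPolynomial.homogeneousComponent 1 f = 0 ∧
    ∃ L : MvPolynomial (Fin 2) k, IsLinearForm L ∧
      MvPolynomial.homogeneousComponent 2 f = L ^ 2 ∧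
      (∀ i, 2 ≤ i → i < m → L ^ 2 ∣ MvPolynomial.homogeneousComponent i f) ∧
      ¬ L ∣ MvPolynomial.homogeneousComponent m f

/-- The `k`-point `v` of `V(F)` is an admissible singularity. -/
def IsAdmissibleAt {k : Type*} [Field k] (F : MvPolynomial (Fin 3) k) (v : Fin 3 → k) : Prop :=
  ∃ f, IsLocalEquation F v f ∧ ∃ m : ℕ, IsRegularMultiplePoint m f ∨ IsDoublePointOfIndex m f

/-- `F` and all its partial derivatives vanish at `v`. -/
def IsSingularAt {K : Type*} [Field K] (F : MvPolynomial (Fin 3) K) (v : Fin 3 → K) : Prop :=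
  MvPolynomial.eval v F = 0 ∧ ∀ i, MvPolynomial.eval v (MvPolynomial.pderiv i F) = 0

/-- `F` regarded as a polynomial over the algebraic closure of `k`. -/
def geom {k : Type*} [Field k] (F : MvPolynomial (Fin 3) k) :
    MvPolynomial (Fin 3) (AlgebraicClosure k) :=
  MvPolynomial.map (algebraMap k (AlgebraicClosure k)) F

/-- Every singular point of `V(F)` over the algebraic closure is a point defined over `k`, and is
an admissible singularity. -/
def HasOnlyAdmissibleSingularities {k : Type*} [Field k] (F : MvPolynomial (Fin 3) k) : Prop :=
  ∀ P : ℙ (AlgebraicClosure k) (Fin 3 → AlgebraicClosure k), IsSingularAt (geom F) P.rep →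
    ∃ v : Fin 3 → k, ∃ hv : (fun i => algebraMap k (AlgebraicClosure k) (v i)) ≠ 0,
      P = Projectivization.mk _ (fun i => algebraMap k (AlgebraicClosure k) (v i)) hv ∧
      IsAdmissibleAt F v

/-! ### Delta invariant and genus -/

/-- The maximal ideal `(x, y)` of `K[x, y]`. -/
def originIdeal (K : Type*) [Field K] : Ideal (MvPolynomial (Fin 2) K) :=
  RingHom.ker (MvPolynomial.constantCoeff : MvPolynomial (Fin 2) K →+* K)

instance (K : Type*) [Field K] : (originIdeal K).IsPrime :=
  RingHom.ker_isPrime _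

/-- The local ring `K[x, y]_{(x, y)} / (f)` of the affine curve `f = 0` at the origin. -/
abbrev LocalRingAtOrigin {K : Type*} [Field K] (f : MvPolynomial (Fin 2) K) : Type _ :=
  Localization.AtPrime (originIdeal K) ⧸
    Ideal.span {algebraMap (MvPolynomial (Fin 2) K) (Localization.AtPrime (originIdeal K)) f}

/-- `dim_K (Ã / A)` for a `K`-algebra `A`, where `Ã` is the integral closure of `A` in its total
ring of fractions; the value is `⊤` if the dimension is infinite. -/
def normalizationDefect (K A : Type*) [Field K] [CommRing A] [Algebra K A] : ℕ∞ :=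
  Cardinal.toENat (Module.rank K
    (integralClosure A (FractionRing A) ⧸
      LinearMap.range (Algebra.linearMap A (integralClosure A (FractionRing A)))))

/-- The delta invariant of the curve `f = 0` at the origin. -/
def localDelta {K : Type*} [Field K] (f : MvPolynomial (Fin 2) K) : ℕ∞ :=
  normalizationDefect K (LocalRingAtOrigin f)

theorem exists_rep_ne_zero {K : Type*} [Field K] (P : ℙ K (Fin 3 → K)) : ∃ i, P.rep i ≠ 0 :=
  Function.ne_iff.mp P.rep_nonzero

/-- The index of a standard affine chart `X_i ≠ 0` containing `P`. -/
def chartIndex {K : Type*} [Field K] (P : ℙ K (Fin 3 → K)) : Fin 3 :=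
  Classical.choose (exists_rep_ne_zero P)

/-- The delta invariant of `V(F)` at the point `P` of the projective plane, computed in a standard
affine chart. It is zero when `P` is not a singular point of `V(F)`. -/
def delta {K : Type*} [Field K] (F : MvPolynomial (Fin 3) K) (P : ℙ K (Fin 3 → K)) : ℕ∞ :=
  localDelta (chartEquation F P.rep (Pi.single (chartIndex P + 1) 1)
    (Pi.single (chartIndex P + 2) 1))

/-- The sum of the delta invariants over all points of the projective plane. -/
def totalDelta {K : Type*} [Field K] (F : MvPolynomial (Fin 3) K) : ℕ∞ :=
  ⨆ s : Finset (ℙ K (Fin 3 → K)), ∑ P ∈ s, delta F P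

/-- The plane curve `V(F)` of degree `f` has (total) delta invariant `d < ∞`, taken over the
algebraic closure, and its normalization has genus `g = (f-1 choose 2) - d`. For a reducible curve
this is the arithmetic genus of the normalization, and may be negative. -/
def HasGenus {k : Type*} [Field k] (F : MvPolynomial (Fin 3) k) (f : ℕ) (g : ℤ) : Prop :=
  ∃ d : ℕ, totalDelta (geom F) = d ∧ g = ((f - 1).choose 2 : ℤ) - d

/-- The numerical cases of interest for the degree `f` and the genus `g`. -/
def CaseOfInterest (f : ℕ) (g : ℤ) : Prop :=
  (f ≤ 7 ∧ 4 ≤ g) ∨ (f = 8 ∧ 7 ≤ g) ∨ (f = 9 ∧ 11 ≤ g)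

/-- `V(F)` is reducible over the algebraic closure: `F = H K` with forms `H`, `K` of positive
degree. -/
def IsReducibleCurve {k : Type*} [Field k] (F : MvPolynomial (Fin 3) k) : Prop :=
  ∃ (a b : ℕ) (H K : MvPolynomial (Fin 3) (AlgebraicClosure k)),
    0 < a ∧ 0 < b ∧ H.IsHomogeneous a ∧ K.IsHomogeneous b ∧ geom F = H * K

/-- `V(F)` contains a line defined over `k`. -/
def ContainsLine {k : Type*} [Field k] (F : MvPolynomial (Fin 3) k) : Prop :=
  ∃ G : MvPolynomial (Fin 3) k, G ≠ 0 ∧ G.IsHomogeneous 1 ∧ G ∣ F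

/-- `V(F)` contains a conic defined over `k` which is irreducible over the algebraic closure. -/
def ContainsIrreducibleConic {k : Type*} [Field k] (F : MvPolynomial (Fin 3) k) : Prop :=
  ∃ G : MvPolynomial (Fin 3) k, G.IsHomogeneous 2 ∧ Irreducible (geom G) ∧ G ∣ F

end

end PlaneCurve

-- The engine is a Bézout inequality (`mul_le_totalDelta`): if `F = H * K` over the algebraic
-- closure with forms of degrees `a` and `b`, then `ab ≤ δ`. Locally, δ of the curve `hk = 0` is at
-- least `dim O/(h, k)`. For coprime `h`, `k` the idempotent `h/(h+k)` separating the two branches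
-- is integral, and its multiple by `x` lies in the local ring only if `x ∈ (h, k)`; a common factor
-- makes δ infinite. Globally, Noether's `AF + BG` argument shows that a form of degree `a + b`
-- lying locally in `(H, K)` at every common zero lies in `(H, K)`, and this ideal has codimension
-- at least `ab` in that degree.
--
-- The bounds on `g` are upper bounds on δ, and by Bézout the smaller degree can only be `1` (with
-- `f ≥ 6`) or `2` (with `f ≥ 7`).
--
-- Line factor (`containsLine_or_cone`). The points where the line meets the residual curve are
-- singular, hence rational, and two of them make the line rational. Suppose there is only one. In
-- type `D_m` the line has the direction of `L`, which is rational. In type `R_m` the full contact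
-- of the residual curve with the line would repeat a factor of `φ_m` unless `m = f`; then the curve
-- is a cone, three of its lines form a cubic factor, and Bézout forbids that.
--
-- Irreducible conic factor. Finite δ makes it a simple factor, and derivations then show that its
-- normalized coefficients are separable over `k`. If they are not Galois invariant, the conic times
-- a different conjugate is a quartic factor, again forbidden by Bézout. A degenerate conic reduces
-- to the case of a line.

universe u

/-! ### Lower bounds for the normalization defect of a product -/

namespace PlaneCurve

/-- Write `Ã` for the integral closure. The kernel of `M → Ã/A` lies in `N`, so `M/N` is a quotient
of a subspace of `Ã/A`. -/
theorem toENat_rank_le_normalizationDefect {K : Type*} {A M : Type u} [Field K] [CommRing A]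
    [Algebra K A] [AddCommGroup M] [Module K M] (Ψ : M →ₗ[K] FractionRing A)
    (hΨ : ∀ m, IsIntegral A (Ψ m)) (N : Submodule K M)
    (hN : ∀ m a, Ψ m = algebraMap A (FractionRing A) a → m ∈ N) :
    Cardinal.toENat (Module.rank K (M ⧸ N)) ≤ normalizationDefect K A := by
  let Ψ' : M →ₗ[K] integralClosure A (FractionRing A) :=
    { toFun := fun m => ⟨Ψ m, hΨ m⟩
      map_add' := fun x y => Subtype.ext (map_add Ψ x y)
      map_smul' := fun c x => Subtype.ext (map_smul Ψ c x) }
  let P := LinearMap.range (Algebra.linearMap A (integralClosure A (FractionRing A)))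
  let Φ : M →ₗ[K] (integralClosure A (FractionRing A)) ⧸ P :=
    (P.mkQ.restrictScalars K).comp Ψ'
  have hker : LinearMap.ker Φ ≤ N := by
    intro m hm
    have h1 : Ψ' m ∈ P := (Submodule.Quotient.mk_eq_zero P).mp hm
    obtain ⟨a, ha⟩ := h1
    exact hN m a (congrArg Subtype.val ha).symm
  refine OrderHomClass.mono Cardinal.toENat (le_trans ?_ (LinearMap.rank_le_of_injective
    ((LinearMap.ker Φ).liftQ Φ le_rfl) ?_))
  · exact LinearMap.rank_le_of_surjective (Submodule.factor hker) (Submodule.factor_surjective hker)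
  · rw [← LinearMap.ker_eq_bot, Submodule.ker_liftQ_eq_bot _ _ _ le_rfl]

section UFD

variable {O : Type u} [CommRing O] [UniqueFactorizationMonoid O]

theorem mk_mem_nonZeroDivisors {f s : O} (h : IsRelPrime f s) :
    Ideal.Quotient.mk (Ideal.span {f}) s ∈ nonZeroDivisors (O ⧸ Ideal.span {f}) := by
  rw [mem_nonZeroDivisors_iff_right]
  intro x hx
  obtain ⟨x, rfl⟩ := Ideal.Quotient.mk_surjective x
  rw [← map_mul, Ideal.Quotient.eq_zero_iff_mem, Ideal.mem_span_singleton] at hx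
  rw [Ideal.Quotient.eq_zero_iff_mem, Ideal.mem_span_singleton]
  exact h.dvd_of_dvd_mul_right hx

theorem rank_quotient_le_normalizationDefect_of_isRelPrime {K : Type*} [Field K] [Algebra K O]
    {h k : O} (hk : IsRelPrime h k) :
    Cardinal.toENat (Module.rank K (O ⧸ Ideal.span {h, k})) ≤
      normalizationDefect K (O ⧸ Ideal.span {h * k}) := by
  set I := Ideal.span {h * k}
  let A := O ⧸ I
  let Q := FractionRing A
  let π : O →ₐ[K] Q := (IsScalarTower.toAlgHom K A Q).comp (Ideal.Quotient.mkₐ K I)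
  have hπ : ∀ x, π x = algebraMap A Q (Ideal.Quotient.mk I x) := fun _ => rfl
  have hinj : Function.Injective (algebraMap A Q) := IsFractionRing.injective A Q
  have hπ0 : ∀ x, π x = 0 ↔ h * k ∣ x := by
    intro x
    rw [hπ, map_eq_zero_iff _ hinj, Ideal.Quotient.eq_zero_iff_mem, Ideal.mem_span_singleton]
  have hrel : IsRelPrime (h * k) (h + k) := by
    refine IsRelPrime.mul_left ?_ ?_
    · intro d hd hd'
      exact hk hd ((dvd_add_right hd).mp hd')
    · intro d hd hd'
      exact hk ((dvd_add_left hd).mp hd') hd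
  have hu : IsUnit (π (h + k)) := IsLocalization.map_units Q ⟨_, mk_mem_nonZeroDivisors hrel⟩
  obtain ⟨v, hv⟩ := hu.exists_right_inv
  have hhk : π h * π k = 0 := by rw [← map_mul, hπ0]
  rw [map_add] at hv
  -- `e = h/(h+k)` is `0` on the branch `h = 0` and `1` on the branch `k = 0`. It is idempotent
  -- because `hk = 0` in `Q`, hence integral.
  set e := π h * v with he
  have hee : e * e = e := by
    linear_combination (π h * v) * hv - v ^ 2 * hhk
  let Ψ : O →ₗ[K] Q := (LinearMap.mulRight K e).comp π.toLinearMap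
  have hΨ : ∀ x, Ψ x = π x * e := fun _ => rfl
  refine toENat_rank_le_normalizationDefect Ψ (fun x => ?_)
    ((Ideal.span {h, k}).restrictScalars K) ?_
  · rw [hΨ, hπ]
    refine IsIntegral.mul isIntegral_algebraMap ⟨Polynomial.X ^ 2 - Polynomial.X, ?_, ?_⟩
    · exact Polynomial.monic_X_pow_sub (by
        simpa using Polynomial.degree_X_le.trans_lt (by norm_num))
    · simp [pow_two, hee]
  · intro x a hxa
    obtain ⟨b, rfl⟩ := Ideal.Quotient.mk_surjective a
    rw [← hπ, hΨ] at hxa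
    -- Multiplying `x e = b` by `h + k` gives `x h ≡ b (h + k)` modulo `hk`. Coprimality then yields
    -- `h ∣ b` and `k ∣ x - b`.
    have h1 : π (x * h - b * (h + k)) = 0 := by
      rw [map_sub, map_mul, map_mul, map_add]
      linear_combination (π h + π k) * hxa - π x * π h * hv
    obtain ⟨c, hc⟩ := (hπ0 _).mp h1
    have h2 : h ∣ b := hk.dvd_of_dvd_mul_right ⟨x - b - k * c, by linear_combination -hc⟩
    have h3 : k ∣ x - b := hk.symm.dvd_of_dvd_mul_right ⟨b + h * c, by linear_combination hc⟩
    obtain ⟨β, hβ⟩ := h2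
    obtain ⟨γ, hγ⟩ := h3
    show x ∈ Ideal.span {h, k}
    rw [Ideal.mem_span_pair]
    exact ⟨β, γ, by linear_combination -hβ - hγ⟩

/-- The pair `x`, `y` certifies dimension at least two, so a nonunit can avoid all prime factors of
`f`: with `f = x ^ n * g` and `x ∤ g`, take `x + g`, or `y` if `g` is a unit. -/
theorem exists_not_isUnit_isRelPrime [IsDomain O] [IsLocalRing O] {x y f : O}
    (hx : Prime x) (hy : ¬ IsUnit y) (hxy : ¬ x ∣ y)
    (hf : f ≠ 0) : ∃ s, ¬ IsUnit s ∧ IsRelPrime f s := by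
  obtain ⟨n, g, hg, rfl⟩ := WfDvdMonoid.max_power_factor hf hx.irreducible
  by_cases hu : IsUnit g
  · refine ⟨y, hy, ?_⟩
    refine IsRelPrime.mul_left (IsRelPrime.pow_left ?_) ?_
    · exact (Irreducible.isRelPrime_iff_not_dvd hx.irreducible).mpr hxy
    · exact fun d hd _ => isUnit_of_dvd_unit hd hu
  · have hxg : IsRelPrime x g := (Irreducible.isRelPrime_iff_not_dvd hx.irreducible).mpr hg
    refine ⟨x + g, ?_, IsRelPrime.mul_left (IsRelPrime.pow_left ?_) ?_⟩
    · exact IsLocalRing.nonunits_add hx.not_isUnit hu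
    · exact fun d hd hd' => hxg hd ((dvd_add_right hd).mp hd')
    · exact fun d hd hd' => hxg ((dvd_add_left hd).mp hd') hd

/-- The class `η` of `qhk` squares to zero, so all of `ηQ` is integral over `A`. It is too large
modulo `A`: finite dimension would allow division by the nonunit `s`. -/
theorem normalizationDefect_eq_top {K : Type*} [Field K] [Algebra K O] [IsLocalRing O]
    {q h k s : O} (hs : ¬ IsUnit s) (hq : ¬ IsUnit q)
    (hrel : IsRelPrime (q * h * (q * k)) s) :
    normalizationDefect K (O ⧸ Ideal.span {q * h * (q * k)}) = ⊤ := by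
  set f := q * h * (q * k) with hf
  set I := Ideal.span {f}
  let A := O ⧸ I
  let Q := FractionRing A
  let π : O →ₐ[K] Q := (IsScalarTower.toAlgHom K A Q).comp (Ideal.Quotient.mkₐ K I)
  have hπ : ∀ x, π x = algebraMap A Q (Ideal.Quotient.mk I x) := fun _ => rfl
  have hinj : Function.Injective (algebraMap A Q) := IsFractionRing.injective A Q
  have hπ0 : ∀ x, π x = 0 ↔ f ∣ x := by
    intro x
    rw [hπ, map_eq_zero_iff _ hinj, Ideal.Quotient.eq_zero_iff_mem, Ideal.mem_span_singleton]
  obtain ⟨v, hv⟩ := (show IsUnit (π s) from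
    IsLocalization.map_units Q ⟨_, mk_mem_nonZeroDivisors hrel⟩).exists_right_inv
  set η := π (q * h * k) with hη
  have hη0 : η * η = 0 := by
    rw [hη, ← map_mul, hπ0]
    exact ⟨h * k, by rw [hf]; ring⟩
  let Ψ : Q →ₗ[K] Q := LinearMap.mulLeft K η
  let N : Submodule K Q :=
    (LinearMap.range (IsScalarTower.toAlgHom K A Q).toLinearMap).comap Ψ
  have hN : ∀ y, y ∈ N ↔ ∃ a, algebraMap A Q a = η * y := fun _ => Iff.rfl
  have hle := toENat_rank_le_normalizationDefect (K := K) Ψ (fun y => ⟨Polynomial.X ^ 2,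
    Polynomial.monic_X_pow 2, by
      simp only [Polynomial.eval₂_X_pow, Ψ, LinearMap.mulLeft_apply]
      linear_combination y ^ 2 * hη0⟩) N (fun y a h => (hN y).mpr ⟨a, h.symm⟩)
  by_contra hne
  have hlt : Module.rank K (Q ⧸ N) < Cardinal.aleph0 := by
    by_contra hge
    rw [not_lt, ← Cardinal.toENat_eq_top] at hge
    exact hne (top_le_iff.mp (hge ▸ hle))
  have hfin : Module.Finite K (Q ⧸ N) := Module.rank_lt_aleph0_iff.mp hlt
  -- Multiplication by `s` is surjective on `Q/N`, since `s` is invertible in `Q`. If `Q/N` has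
  -- finite dimension it is also injective, so `1 ∈ N` forces `1/s ∈ N`, that is `η/s ∈ A`.
  have hstable : N ≤ N.comap (LinearMap.mulLeft K (π s)) := by
    intro y hy
    obtain ⟨a, ha⟩ := (hN y).mp hy
    refine (hN _).mpr ⟨Ideal.Quotient.mk I s * a, ?_⟩
    rw [map_mul, ha, ← hπ, LinearMap.mulLeft_apply]
    ring
  let T : (Q ⧸ N) →ₗ[K] (Q ⧸ N) := N.mapQ N (LinearMap.mulLeft K (π s)) hstable
  have hsurj : Function.Surjective T := by
    intro z
    obtain ⟨z, rfl⟩ := N.mkQ_surjective z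
    refine ⟨N.mkQ (v * z), ?_⟩
    simp only [T, Submodule.mkQ_apply, Submodule.mapQ_apply, LinearMap.mulLeft_apply]
    rw [← mul_assoc, hv, one_mul]
  have hTinj := LinearMap.injective_iff_surjective.mpr hsurj
  have hvN : v ∈ N := by
    rw [← Submodule.Quotient.mk_eq_zero]
    apply hTinj
    rw [map_zero]
    simp only [T, Submodule.mapQ_apply, LinearMap.mulLeft_apply]
    rw [hv, Submodule.Quotient.mk_eq_zero]
    exact (hN 1).mpr ⟨Ideal.Quotient.mk I (q * h * k), by rw [← hπ, mul_one]⟩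
  obtain ⟨a, ha⟩ := (hN v).mp hvN
  obtain ⟨b, rfl⟩ := Ideal.Quotient.mk_surjective a
  rw [← hπ] at ha
  have h1 : π (q * h * k - s * b) = 0 := by
    rw [map_sub, map_mul π s, ha, ← hη]
    linear_combination -η * hv
  obtain ⟨c, hc⟩ := (hπ0 _).mp h1
  have h2 : IsRelPrime s (q * h * k) :=
    (IsRelPrime.of_dvd_left hrel ⟨q, by rw [hf]; ring⟩).symm
  -- From `qhk = s b + q²hk c` and the coprimality of `s` and `qhk`, the nonunit `s` divides `1 -
  -- qc`, which is a unit because `q` is not.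
  have h3 : s ∣ 1 - q * c := h2.dvd_of_dvd_mul_left ⟨b, by rw [hf] at hc; linear_combination hc⟩
  have h4 : IsUnit (1 - q * c) := by
    by_contra hnu
    have := IsLocalRing.nonunits_add hnu (mul_mem_nonunits_left (b := c) hq)
    simp at this
  exact hs (isUnit_of_dvd_unit h3 h4)

theorem rank_quotient_le_normalizationDefect {K : Type*} [Field K] [Algebra K O] [IsDomain O]
    [IsLocalRing O] {x y : O} (hx : Prime x) (hy : ¬ IsUnit y)
    (hxy : ¬ x ∣ y) {h k : O} (hhk : h * k ≠ 0) :
    Cardinal.toENat (Module.rank K (O ⧸ Ideal.span {h, k})) ≤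
      normalizationDefect K (O ⧸ Ideal.span {h * k}) := by
  by_cases hrel : IsRelPrime h k
  · exact rank_quotient_le_normalizationDefect_of_isRelPrime hrel
  · simp only [IsRelPrime, not_forall] at hrel
    obtain ⟨q, ⟨h', rfl⟩, ⟨k', rfl⟩, hq⟩ := hrel
    obtain ⟨s, hs, hrel⟩ := exists_not_isUnit_isRelPrime hx hy hxy hhk
    rw [normalizationDefect_eq_top hs hq hrel]
    exact le_top

end UFD

/-! ### The local ring of the affine plane at the origin -/

section Chart

variable {K : Type u} [Field K]

theorem isUnit_algebraMap_originLocalization_iff (p : MvPolynomial (Fin 2) K) :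
    IsUnit (algebraMap (MvPolynomial (Fin 2) K) (Localization.AtPrime (originIdeal K)) p) ↔
      MvPolynomial.constantCoeff p ≠ 0 := by
  rw [IsLocalization.AtPrime.isUnit_to_map_iff _ (originIdeal K)]
  rfl

theorem toENat_rank_le_localDelta {h k : MvPolynomial (Fin 2) K} (hhk : h * k ≠ 0) :
    Cardinal.toENat (Module.rank K (Localization.AtPrime (originIdeal K) ⧸
      Ideal.span {algebraMap _ (Localization.AtPrime (originIdeal K)) h,
        algebraMap _ (Localization.AtPrime (originIdeal K)) k})) ≤ localDelta (h * k) := by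
  have hle : (originIdeal K).primeCompl ≤ nonZeroDivisors (MvPolynomial (Fin 2) K) :=
    Ideal.primeCompl_le_nonZeroDivisors _
  have hinj := IsLocalization.injective (Localization.AtPrime (originIdeal K)) hle
  have hX : ∀ i, ¬ IsUnit (algebraMap (MvPolynomial (Fin 2) K)
      (Localization.AtPrime (originIdeal K)) (MvPolynomial.X i)) := by
    intro i
    rw [isUnit_algebraMap_originLocalization_iff]
    simp
  unfold localDelta LocalRingAtOrigin
  rw [map_mul]
  have hX0 := MvPolynomial.X_prime (R := K) (i := (0 : Fin 2))
  have hspan : Ideal.map (algebraMap (MvPolynomial (Fin 2) K)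
      (Localization.AtPrime (originIdeal K))) (Ideal.span {MvPolynomial.X 0}) =
      Ideal.span {algebraMap (MvPolynomial (Fin 2) K) _ (MvPolynomial.X 0)} := by
    rw [Ideal.map_span, Set.image_singleton]
  have hmem : ∀ s ∈ (originIdeal K).primeCompl, ¬ (MvPolynomial.X 0 : MvPolynomial (Fin 2) K) ∣ s := by
    rintro s hs ⟨t, rfl⟩
    exact hs (show MvPolynomial.constantCoeff _ = 0 by simp)
  have hprime : Prime (algebraMap (MvPolynomial (Fin 2) K)
      (Localization.AtPrime (originIdeal K)) (MvPolynomial.X 0)) := by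
    rw [← Ideal.span_singleton_prime ((map_ne_zero_iff _ hinj).mpr hX0.ne_zero), ← hspan]
    refine IsLocalization.isPrime_of_isPrime_disjoint (originIdeal K).primeCompl _ _
      ((Ideal.span_singleton_prime hX0.ne_zero).mpr hX0) ?_
    rw [Set.disjoint_left]
    intro s hs hs'
    exact hmem s hs (Ideal.mem_span_singleton.mp hs')
  refine rank_quotient_le_normalizationDefect (x := algebraMap (MvPolynomial (Fin 2) K) _ (MvPolynomial.X 0))
    (y := algebraMap (MvPolynomial (Fin 2) K) _ (MvPolynomial.X 1)) hprime (hX 1) ?_ ?_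
  · rw [← Ideal.mem_span_singleton, ← hspan,
      IsLocalization.algebraMap_mem_map_algebraMap_iff (originIdeal K).primeCompl]
    rintro ⟨s, hs, hs'⟩
    rw [Ideal.mem_span_singleton] at hs'
    rcases hX0.dvd_or_dvd hs' with h | h
    · exact hmem s hs h
    · rw [MvPolynomial.X_dvd_X] at h
      simp at h
  · rw [← map_mul]
    exact (map_ne_zero_iff _ hinj).mpr hhk
end Chart

open MvPolynomial

/-! ### Passing between forms and affine charts -/

theorem aeval_smul_of_isHomogeneous {σ R A : Type*} [CommSemiring R] [CommSemiring A] [Algebra R A]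
    {G : MvPolynomial σ R} {n : ℕ} (hG : G.IsHomogeneous n) (c : A) (x : σ → A) :
    aeval (fun i => c * x i) G = c ^ n * aeval x G := by
  rw [aeval_def, aeval_def, eval₂_eq, eval₂_eq, Finset.mul_sum]
  refine Finset.sum_congr rfl fun d hd => ?_
  have hdeg : ∑ i ∈ d.support, d i = n := by
    rw [← Finsupp.degree_apply]
    by_contra h
    exact (mem_support_iff.mp hd) (hG.coeff_eq_zero h)
  simp_rw [mul_pow]
  rw [Finset.prod_mul_distrib, Finset.prod_pow_eq_pow_sum, hdeg]
  ring

theorem clear_denominators {L : Type*} [Field L] {x c α β s g h h' : L} {a b N M : ℕ} (hx : x ≠ 0)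
    (key : α * ((c / x) ^ a * h) + β * ((c / x) ^ b * h') = s * ((c / x) ^ N * g)) :
    x ^ M * α * (c ^ a * x ^ (N + b)) * h + x ^ M * β * (c ^ b * x ^ (N + a)) * h' =
      x ^ M * s * (c ^ N * x ^ (a + b)) * g := by
  have hn : ∀ n, c ^ n = (c / x) ^ n * x ^ n := fun n => by rw [← mul_pow, div_mul_cancel₀ c hx]
  rw [hn a, hn b, hn N]
  simp only [pow_add]
  linear_combination x ^ M * x ^ N * x ^ a * x ^ b * key

section Homogenize

variable {K : Type*} [Field K] (v : Fin 3 → K) (i : Fin 3)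

/-- The standard affine chart around `v`, as a homomorphism of polynomial rings. -/
noncomputable def standardChart : MvPolynomial (Fin 3) K →ₐ[K] MvPolynomial (Fin 2) K :=
  aeval fun j => C (v j) + C ((Pi.single (i + 1) 1 : Fin 3 → K) j) * X 0
    + C ((Pi.single (i + 2) 1 : Fin 3 → K) j) * X 1

/-- The inverse of the standard chart, with values in rational functions. -/
noncomputable def homogenization :
    MvPolynomial (Fin 2) K →ₐ[K] FractionRing (MvPolynomial (Fin 3) K) :=
  aeval ![algebraMap (MvPolynomial (Fin 3) K) _ (C (v i) * X (i + 1) - C (v (i + 1)) * X i) /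
      algebraMap (MvPolynomial (Fin 3) K) _ (X i),
    algebraMap (MvPolynomial (Fin 3) K) _ (C (v i) * X (i + 2) - C (v (i + 2)) * X i) /
      algebraMap (MvPolynomial (Fin 3) K) _ (X i)]

theorem constantCoeff_standardChart (G : MvPolynomial (Fin 3) K) :
    constantCoeff (standardChart v i G) = eval v G := by
  have : (constantCoeff.comp (standardChart v i).toRingHom) = eval v := by
    ext <;> simp [standardChart]
  exact DFunLike.congr_fun this G

theorem algebraMap_X_ne_zero :
    algebraMap (MvPolynomial (Fin 3) K) (FractionRing (MvPolynomial (Fin 3) K)) (X i) ≠ 0 :=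
  (map_ne_zero_iff _ (IsFractionRing.injective _ _)).mpr (X_ne_zero i)

/-- The composite substitution sends `X j` to `(v i / X i) * X j`, so a form of degree `n` is only
rescaled. -/
theorem homogenization_standardChart {G : MvPolynomial (Fin 3) K} {n : ℕ}
    (hG : G.IsHomogeneous n) :
    homogenization v i (standardChart v i G) =
      (algebraMap (MvPolynomial (Fin 3) K) _ (C (v i)) / algebraMap (MvPolynomial (Fin 3) K) _ (X i)) ^ n *
        algebraMap _ _ G := by
  have hX := algebraMap_X_ne_zero (K := K) i
  set c := algebraMap (MvPolynomial (Fin 3) K) (FractionRing (MvPolynomial (Fin 3) K)) (C (v i)) /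
    algebraMap (MvPolynomial (Fin 3) K) _ (X i) with hc
  have h1 : (homogenization v i).comp (standardChart v i) =
      aeval (fun j => c * algebraMap (MvPolynomial (Fin 3) K) _ (X j)) := by
    apply MvPolynomial.algHom_ext
    intro j
    have hC : ∀ a : K, (homogenization v i) (C a) = algebraMap (MvPolynomial (Fin 3) K) _ (C a) := by
      intro a
      rw [← algebraMap_eq, AlgHom.commutes, IsScalarTower.algebraMap_apply K (MvPolynomial (Fin 3) K)]
      rfl
    have hj : j = i ∨ j = i + 1 ∨ j = i + 2 := by
      exact (by decide : ∀ i j : Fin 3, j = i ∨ j = i + 1 ∨ j = i + 2) i j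
    have e1 : i ≠ i + 1 := (by decide : ∀ i : Fin 3, i ≠ i + 1) i
    have e2 : i ≠ i + 2 := (by decide : ∀ i : Fin 3, i ≠ i + 2) i
    have e3 : i + 1 ≠ i + 2 := (by decide : ∀ i : Fin 3, i + 1 ≠ i + 2) i
    rw [AlgHom.comp_apply, aeval_X, standardChart, aeval_X, map_add, map_add, map_mul, map_mul, hC,
      hC, hC]
    simp only [homogenization, aeval_X, Matrix.cons_val_zero, Matrix.cons_val_one]
    rcases hj with rfl | rfl | rfl
    · simp [e1, e2, hc, hX]
    · simp [e3, hc]; field_simp; ring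
    · simp [e3.symm, hc]; field_simp; ring
  rw [← AlgHom.comp_apply, h1, aeval_smul_of_isHomogeneous hG]
  congr 1
  have : (aeval fun j => algebraMap (MvPolynomial (Fin 3) K)
      (FractionRing (MvPolynomial (Fin 3) K)) (X j)) =
      IsScalarTower.toAlgHom K (MvPolynomial (Fin 3) K) (FractionRing (MvPolynomial (Fin 3) K)) := by
    apply MvPolynomial.algHom_ext
    simp
  rw [this]
  rfl

theorem standardChart_ne_zero {v : Fin 3 → K} {i : Fin 3} (hv : v i ≠ 0)
    {G : MvPolynomial (Fin 3) K} {n : ℕ} (hG : G.IsHomogeneous n) (h0 : G ≠ 0) :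
    standardChart v i G ≠ 0 := by
  intro h
  have := homogenization_standardChart v i hG
  rw [h, map_zero, eq_comm, mul_eq_zero, or_iff_left
    ((map_ne_zero_iff _ (IsFractionRing.injective _ _)).mpr h0)] at this
  have h2 := eq_zero_of_pow_eq_zero this
  rw [div_eq_zero_iff, or_iff_left (algebraMap_X_ne_zero i),
    map_eq_zero_iff _ (IsFractionRing.injective _ _), C_eq_zero] at h2
  exact hv h2

/-- Every large power of `X i` clears the denominators, so several polynomials can share one
exponent. The value at `v` is recorded so that a polynomial invertible at the origin gives a form
not vanishing at `v`. -/
theorem exists_isHomogeneous_homogenization (r : MvPolynomial (Fin 2) K) :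
    ∃ n₀, ∀ n ≥ n₀, ∃ p : MvPolynomial (Fin 3) K, p.IsHomogeneous n ∧
      algebraMap _ _ p = algebraMap (MvPolynomial (Fin 3) K) _ (X i) ^ n * homogenization v i r ∧
      eval v p = v i ^ n * constantCoeff r := by
  have hX := algebraMap_X_ne_zero (K := K) i
  induction r using MvPolynomial.induction_on with
  | C a =>
    refine ⟨0, fun n _ => ⟨X i ^ n * C a, ?_, ?_, by simp⟩⟩
    · simpa using (isHomogeneous_X_pow i n).mul (isHomogeneous_C (Fin 3) a)
    · rw [map_mul, map_pow, ← algebraMap_eq, ← algebraMap_eq, AlgHom.commutes,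
        ← IsScalarTower.algebraMap_apply]
  | add p q hp hq =>
    obtain ⟨n₁, h₁⟩ := hp
    obtain ⟨n₂, h₂⟩ := hq
    refine ⟨max n₁ n₂, fun n hn => ?_⟩
    obtain ⟨p', a1, a2, a3⟩ := h₁ n (le_trans (le_max_left _ _) hn)
    obtain ⟨q', b1, b2, b3⟩ := h₂ n (le_trans (le_max_right _ _) hn)
    refine ⟨p' + q', a1.add b1, ?_, ?_⟩
    · rw [map_add, map_add, a2, b2, mul_add]
    · rw [map_add, map_add, a3, b3, mul_add]
  | mul_X p j hp =>
    obtain ⟨n₁, h₁⟩ := hp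
    have hj : ∃ j' : Fin 3, homogenization v i (X j) =
        algebraMap (MvPolynomial (Fin 3) K) _ (C (v i) * X j' - C (v j') * X i) /
          algebraMap (MvPolynomial (Fin 3) K) _ (X i) := by
      fin_cases j
      · exact ⟨i + 1, by simp [homogenization]⟩
      · exact ⟨i + 2, by simp [homogenization]⟩
    obtain ⟨j', hj'⟩ := hj
    refine ⟨n₁ + 1, fun n hn => ?_⟩
    obtain ⟨n, rfl⟩ : ∃ m, n = m + 1 := ⟨n - 1, by omega⟩
    obtain ⟨p', a1, a2, a3⟩ := h₁ n (by omega)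
    refine ⟨p' * (C (v i) * X j' - C (v j') * X i), a1.mul
      ((isHomogeneous_C_mul_X _ _).sub (isHomogeneous_C_mul_X _ _)), ?_, ?_⟩
    · rw [map_mul, map_mul, a2, hj']
      field_simp
      ring
    · simp [mul_comm]

theorem exists_mul_mem_span_of_local {v : Fin 3 → K} {i : Fin 3} (hv : v i ≠ 0)
    {H H' G : MvPolynomial (Fin 3) K} {a b N : ℕ} (hH : H.IsHomogeneous a)
    (hH' : H'.IsHomogeneous b) (hG : G.IsHomogeneous N)
    (hloc : algebraMap _ (Localization.AtPrime (originIdeal K)) (standardChart v i G) ∈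
      Ideal.span {algebraMap _ (Localization.AtPrime (originIdeal K)) (standardChart v i H),
        algebraMap _ (Localization.AtPrime (originIdeal K)) (standardChart v i H')}) :
    ∃ (m : ℕ) (T : MvPolynomial (Fin 3) K), T.IsHomogeneous m ∧ eval v T ≠ 0 ∧
      T * G ∈ Ideal.span {H, H'} := by
  have hspan : Ideal.map (algebraMap (MvPolynomial (Fin 2) K)
      (Localization.AtPrime (originIdeal K)))
        (Ideal.span {standardChart v i H, standardChart v i H'}) =
      Ideal.span {algebraMap _ _ (standardChart v i H), algebraMap _ _ (standardChart v i H')} := by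
    rw [Ideal.map_span, Set.image_pair]
  rw [← hspan, IsLocalization.algebraMap_mem_map_algebraMap_iff (originIdeal K).primeCompl] at hloc
  obtain ⟨s, hs, hmem⟩ := hloc
  obtain ⟨α, β, hαβ⟩ := Ideal.mem_span_pair.mp hmem
  obtain ⟨n₁, h₁⟩ := exists_isHomogeneous_homogenization v i s
  obtain ⟨n₂, h₂⟩ := exists_isHomogeneous_homogenization v i α
  obtain ⟨n₃, h₃⟩ := exists_isHomogeneous_homogenization v i β
  obtain ⟨s', s1, s2, s3⟩ := h₁ (n₁ + n₂ + n₃) (by omega)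
  obtain ⟨α', -, α2, -⟩ := h₂ (n₁ + n₂ + n₃) (by omega)
  obtain ⟨β', -, β2, -⟩ := h₃ (n₁ + n₂ + n₃) (by omega)
  have hX := algebraMap_X_ne_zero (K := K) i
  have hs0 : constantCoeff s ≠ 0 := hs
  refine ⟨_, s' * (C (v i ^ N) * X i ^ (a + b)),
    s1.mul ((isHomogeneous_C (Fin 3) _).mul (isHomogeneous_X_pow i _)), ?_, ?_⟩
  · simp [s3, hv, hs0]
  · rw [Ideal.mem_span_pair]
    refine ⟨α' * (C (v i ^ a) * X i ^ (N + b)), β' * (C (v i ^ b) * X i ^ (N + a)), ?_⟩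
    apply IsFractionRing.injective (MvPolynomial (Fin 3) K) (FractionRing (MvPolynomial (Fin 3) K))
    have key := congrArg (homogenization v i) hαβ
    simp only [map_add, map_mul, homogenization_standardChart v i hH,
      homogenization_standardChart v i hH', homogenization_standardChart v i hG] at key
    simp only [map_add, map_mul, map_pow, s2, α2, β2]
    exact clear_denominators hX key

end Homogenize

/-! ### Restriction to a line missing the common zeros -/

section Line

variable {K : Type*} [Field K] (z : Fin 3 → K) (i : Fin 3)

/-- The linear form with coefficient vector `z`. -/
noncomputable def linearForm : MvPolynomial (Fin 3) K := ∑ j, C (z j) * X j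

theorem isHomogeneous_linearForm : (linearForm z).IsHomogeneous 1 :=
  IsHomogeneous.sum _ _ _ fun _ _ => isHomogeneous_C_mul_X _ _

theorem eval_linearForm (x : Fin 3 → K) : eval x (linearForm z) = ∑ j, z j * x j := by
  simp [linearForm]

theorem linearForm_eq : linearForm z =
    C (z i) * X i + C (z (i + 1)) * X (i + 1) + C (z (i + 2)) * X (i + 2) := by
  fin_cases i <;> simp [linearForm, Fin.sum_univ_three] <;> ring

/-- Coordinates on the line with equation `z`, assuming that `z i ≠ 0`. -/
noncomputable def lineCoordinates (j : Fin 3) : MvPolynomial (Fin 2) K :=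
  C ((Pi.single (i + 1) (z i) - Pi.single i (z (i + 1)) : Fin 3 → K) j) * X 0 +
    C ((Pi.single (i + 2) (z i) - Pi.single i (z (i + 2)) : Fin 3 → K) j) * X 1

/-- Restriction of polynomials to the line with equation `z`, assuming that `z i ≠ 0`. -/
noncomputable def lineRestriction : MvPolynomial (Fin 3) K →ₐ[K] MvPolynomial (Fin 2) K :=
  aeval (lineCoordinates z i)

theorem isHomogeneous_lineRestriction {G : MvPolynomial (Fin 3) K} {n : ℕ}
    (hG : G.IsHomogeneous n) : (lineRestriction z i G).IsHomogeneous n := by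
  have := hG.aeval (lineCoordinates z i) (n := 1)
    fun j => (isHomogeneous_C_mul_X _ _).add (isHomogeneous_C_mul_X _ _)
  rwa [one_mul] at this

theorem lineCoordinates_self : lineCoordinates z i i = - (C (z (i + 1)) * X 0 + C (z (i + 2)) * X 1) := by
  fin_cases i <;> simp [lineCoordinates] <;> ring

theorem lineCoordinates_add_one : lineCoordinates z i (i + 1) = C (z i) * X 0 := by
  fin_cases i <;> simp [lineCoordinates]

theorem lineCoordinates_add_two : lineCoordinates z i (i + 2) = C (z i) * X 1 := by
  fin_cases i <;> simp [lineCoordinates]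

theorem lineRestriction_linearForm : lineRestriction z i (linearForm z) = 0 := by
  rw [linearForm_eq z i]
  simp only [lineRestriction, map_add, map_mul, aeval_X, lineCoordinates_self,
    lineCoordinates_add_one, lineCoordinates_add_two, algHom_C, algebraMap_eq]
  ring

/-- Restriction to the line has a section `σ`, and `σ` after restriction is the identity modulo the
linear form. -/
theorem linearForm_dvd_of_lineRestriction_eq_zero (hz : z i ≠ 0) {G : MvPolynomial (Fin 3) K}
    (hG : lineRestriction z i G = 0) : linearForm z ∣ G := by
  let σ : MvPolynomial (Fin 2) K →ₐ[K] MvPolynomial (Fin 3) K :=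
    aeval ![C (z i)⁻¹ * X (i + 1), C (z i)⁻¹ * X (i + 2)]
  let q := Ideal.Quotient.mkₐ K (Ideal.span {linearForm z})
  have h1 : (q.comp σ).comp (lineRestriction z i) = q := by
    apply MvPolynomial.algHom_ext
    intro j
    have hC : (C (z i) : MvPolynomial (Fin 3) K) * C (z i)⁻¹ = 1 := by
      rw [← C_mul, mul_inv_cancel₀ hz, C_1]
    have hC' : ∀ a, σ (C a) = C a := fun a => by rw [algHom_C, algebraMap_eq]
    have h0 : σ (X 0) = C (z i)⁻¹ * X (i + 1) := by simp [σ]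
    have h0' : σ (X 1) = C (z i)⁻¹ * X (i + 2) := by simp [σ]
    rw [AlgHom.comp_apply, AlgHom.comp_apply]
    rcases (by decide : ∀ i j : Fin 3, j = i ∨ j = i + 1 ∨ j = i + 2) i j with rfl | rfl | rfl
    · rw [lineRestriction, aeval_X, lineCoordinates_self]
      refine Ideal.Quotient.eq.mpr (Ideal.mem_span_singleton.mpr ⟨- C (z j)⁻¹, ?_⟩)
      rw [map_neg, map_add, map_mul, map_mul, hC', hC', h0, h0', linearForm_eq z j]
      linear_combination X j * hC
    · rw [lineRestriction, aeval_X, lineCoordinates_add_one, map_mul, hC', h0, ← mul_assoc, hC, one_mul]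
    · rw [lineRestriction, aeval_X, lineCoordinates_add_two, map_mul, hC', h0', ← mul_assoc, hC, one_mul]
  have h2 : q G = 0 := by
    rw [← h1, AlgHom.comp_apply, hG, map_zero]
  exact Ideal.mem_span_singleton.mp (Ideal.Quotient.eq_zero_iff_mem.mp h2)

theorem lineRestriction_surjective (hz : z i ≠ 0) :
    Function.Surjective (lineRestriction z i) := by
  intro p
  refine ⟨aeval ![C (z i)⁻¹ * X (i + 1), C (z i)⁻¹ * X (i + 2)] p, ?_⟩
  have hC : (C (z i)⁻¹ : MvPolynomial (Fin 2) K) * C (z i) = 1 := by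
    rw [← C_mul, inv_mul_cancel₀ hz, C_1]
  rw [← AlgHom.comp_apply]
  convert AlgHom.id_apply (R := K) p
  apply MvPolynomial.algHom_ext
  intro j
  fin_cases j
  · simp [lineRestriction, lineCoordinates_add_one, algHom_C, algebraMap_eq, ← mul_assoc, hC]
  · simp [lineRestriction, lineCoordinates_add_two, algHom_C, algebraMap_eq, ← mul_assoc, hC]

/-- The restrictions have no common zero except the origin, so by the Nullstellensatz their ideal
contains powers of both variables. A common divisor divides both powers and is a unit. -/
theorem isRelPrime_lineRestriction [IsAlgClosed K] (hz : z i ≠ 0) {H H' : MvPolynomial (Fin 3) K}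
    (hHH' : ∀ x ≠ 0, eval x H = 0 → eval x H' = 0 → eval x (linearForm z) ≠ 0) :
    IsRelPrime (lineRestriction z i H) (lineRestriction z i H') := by
  set h := lineRestriction z i H
  set h' := lineRestriction z i H'
  have hev : ∀ (x : Fin 2 → K) (G : MvPolynomial (Fin 3) K),
      eval x (lineRestriction z i G) = eval (fun j => eval x (lineCoordinates z i j)) G := by
    intro x G
    have : (eval x).comp (lineRestriction z i).toRingHom =
        eval (fun j => eval x (lineCoordinates z i j)) := by
      ext <;> simp [lineRestriction, algebraMap_eq]
    exact DFunLike.congr_fun this G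
  have hzero : ∀ j : Fin 2, X j ∈ (Ideal.span {h, h'}).radical := by
    intro j
    rw [← vanishingIdeal_zeroLocus_eq_radical (K := K), mem_vanishingIdeal_iff]
    intro x hx
    by_contra hxj
    rw [aeval_X] at hxj
    have hmem : ∀ p ∈ Ideal.span {h, h'}, eval x p = 0 := fun p hp => hx p hp
    refine hHH' (fun j => eval x (lineCoordinates z i j)) ?_ ?_ ?_ ?_
    · intro h0
      have h1 := congrFun h0 (i + 1)
      have h2 := congrFun h0 (i + 2)
      simp [lineCoordinates_add_one, lineCoordinates_add_two, hz] at h1 h2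
      fin_cases j
      · exact hxj h1
      · exact hxj h2
    · rw [← hev]; exact hmem h (Ideal.subset_span (by simp))
    · rw [← hev]; exact hmem h' (Ideal.subset_span (by simp))
    · rw [← hev, lineRestriction_linearForm, map_zero]
  intro d hd hd'
  have hdvd : ∀ j : Fin 2, ∃ n, d ∣ X j ^ n := by
    intro j
    obtain ⟨n, hn⟩ := hzero j
    obtain ⟨α, β, hαβ⟩ := Ideal.mem_span_pair.mp hn
    exact ⟨n, hαβ ▸ (hd.mul_left α).add (hd'.mul_left β)⟩
  obtain ⟨n, hn⟩ := hdvd 0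
  obtain ⟨m, hm⟩ := hdvd 1
  have hXX : IsRelPrime (X 0 : MvPolynomial (Fin 2) K) (X 1) := by
    refine (Irreducible.isRelPrime_iff_not_dvd (X_prime (R := K) (i := (0 : Fin 2))).irreducible).mpr ?_
    rw [X_dvd_X]
    simp
  exact (IsRelPrime.pow_left (IsRelPrime.pow_right hXX)) hn hm

/-- The linear form is not a zero divisor modulo `(H, H')`. On the line the relation becomes `αH +
βH' = 0` with coprime restrictions, so `(α, β) = γ (H', -H)` there. Lifting `γ` and subtracting this
Koszul relation makes both coefficients divisible by the linear form. -/
theorem mem_span_of_linearForm_mul_mem [IsAlgClosed K] (hz : z i ≠ 0)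
    {H H' G : MvPolynomial (Fin 3) K}
    (hHH' : ∀ x ≠ 0, eval x H = 0 → eval x H' = 0 → eval x (linearForm z) ≠ 0)
    (hG : linearForm z * G ∈ Ideal.span {H, H'}) : G ∈ Ideal.span {H, H'} := by
  have hrel := isRelPrime_lineRestriction z i hz hHH'
  obtain ⟨α, β, hαβ⟩ := Ideal.mem_span_pair.mp hG
  set τ := lineRestriction z i
  have h0 : τ α * τ H + τ β * τ H' = 0 := by
    rw [← map_mul, ← map_mul, ← map_add, hαβ, map_mul, lineRestriction_linearForm, zero_mul]
  have hz0 : linearForm z ≠ 0 := by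
    intro h
    have h1 := eval_linearForm z (Pi.single i 1)
    rw [h, map_zero] at h1
    exact hz (by simpa [Pi.single_apply] using h1.symm)
  obtain ⟨γ, hγ, hβ⟩ : ∃ γ, τ α = τ H' * γ ∧ τ β + τ H * γ = 0 := by
    -- If `H'` vanishes on the line, coprimality makes the restriction of `H` a unit, so `γ` is
    -- obtained by dividing by it instead.
    by_cases hH' : τ H' = 0
    · have hu : IsUnit (τ H) := hrel dvd_rfl (hH' ▸ dvd_zero _)
      obtain ⟨γ, hγ⟩ := hu.dvd (a := - τ β)
      rw [hH', mul_zero, add_zero, hu.mul_left_eq_zero] at h0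
      exact ⟨γ, by rw [h0, hH', zero_mul], by rw [← hγ]; ring⟩
    · obtain ⟨γ, hγ⟩ : τ H' ∣ τ α := hrel.symm.dvd_of_dvd_mul_right ⟨- τ β, by linear_combination h0⟩
      refine ⟨γ, hγ, (mul_eq_zero_iff_left hH').mp ?_⟩
      linear_combination h0 - τ H * hγ
  obtain ⟨γ, rfl⟩ := lineRestriction_surjective z i hz γ
  obtain ⟨α', hα'⟩ := linearForm_dvd_of_lineRestriction_eq_zero z i hz (G := α - H' * γ)
    (by rw [map_sub, map_mul, sub_eq_zero]; exact hγ)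
  obtain ⟨β', hβ'⟩ := linearForm_dvd_of_lineRestriction_eq_zero z i hz (G := β + H * γ)
    (by rw [map_add, map_mul]; exact hβ)
  refine Ideal.mem_span_pair.mpr ⟨α', β', ?_⟩
  apply mul_left_cancel₀ hz0
  linear_combination hαβ - H * hα' - H' * hβ'

end Line

/-! ### Dimension count in degree `a + b` -/

section Degree

variable {σ R : Type*} [CommRing R]

theorem homogeneousComponent_mul_of_isHomogeneous {H : MvPolynomial σ R} {a : ℕ}
    (hH : H.IsHomogeneous a) (α : MvPolynomial σ R) (n : ℕ) :
    homogeneousComponent (n + a) (α * H) = homogeneousComponent n α * H := by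
  conv_lhs => rw [← sum_homogeneousComponent α, Finset.sum_mul, map_sum]
  have h1 : ∀ i, homogeneousComponent (n + a) (homogeneousComponent i α * H) =
      if i = n then homogeneousComponent n α * H else 0 := by
    intro i
    rw [homogeneousComponent_of_mem ((homogeneousComponent_isHomogeneous i α).mul hH)]
    by_cases h : i = n
    · subst h; simp
    · rw [if_neg (by omega), if_neg h]
  simp_rw [h1]
  rw [Finset.sum_ite_eq']
  split_ifs with h
  · rfl
  · rw [homogeneousComponent_eq_zero n α (by simpa using h), zero_mul]

theorem exists_isHomogeneous_of_mem_span {H H' G : MvPolynomial σ R} {a b : ℕ}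
    (hH : H.IsHomogeneous a) (hH' : H'.IsHomogeneous b) (hG : G.IsHomogeneous (a + b))
    (hmem : G ∈ Ideal.span {H, H'}) :
    ∃ α β, IsHomogeneous α b ∧ IsHomogeneous β a ∧ α * H + β * H' = G := by
  obtain ⟨α, β, h⟩ := Ideal.mem_span_pair.mp hmem
  refine ⟨homogeneousComponent b α, homogeneousComponent a β, homogeneousComponent_isHomogeneous _ _,
    homogeneousComponent_isHomogeneous _ _, ?_⟩
  rw [← homogeneousComponent_mul_of_isHomogeneous hH, ← homogeneousComponent_mul_of_isHomogeneous hH',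
    add_comm b a, ← map_add, h, homogeneousComponent_eq_self hG]

end Degree

section Dimension

variable {K : Type*} [Field K]

theorem finrank_homogeneousSubmodule (n : ℕ) :
    Module.finrank K (homogeneousSubmodule (Fin 3) K n) = (n + 2).choose 2 := by
  have h1 : homogeneousSubmodule (Fin 3) K n = restrictSupport K {d | d.degree = n} :=
    homogeneousSubmodule_eq_finsupp_supported (Fin 3) K n
  rw [h1, Module.finrank_eq_nat_card_basis (basisRestrictSupport K _), Nat.card_coe_set_eq]
  have h2 : {d : Fin 3 →₀ ℕ | d.degree = n} = ↑(Finset.finsuppAntidiag (Finset.univ : Finset (Fin 3)) n) := by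
    ext d
    simp [Finset.mem_finsuppAntidiag, Finsupp.degree_eq_sum]
  rw [h2, Set.ncard_coe_finset, Finset.card_finsuppAntidiag_nat_eq_choose, Finset.card_fin]
  rw [show 3 + n - 1 = n + 2 by omega, ← Nat.choose_symm (by omega)]
  congr 1
  omega

instance (n : ℕ) : Module.Finite K (homogeneousSubmodule (Fin 3) K n) :=
  Module.Finite.iff_fg.mpr (homogeneousSubmodule_fg (Fin 3) K n)

/-- The degree `n` part of the ideal generated by two polynomials. -/
noncomputable def spanPairDegree (H H' : MvPolynomial (Fin 3) K) (n : ℕ) :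
    Submodule K (homogeneousSubmodule (Fin 3) K n) :=
  ((Ideal.span {H, H'}).restrictScalars K).comap (homogeneousSubmodule (Fin 3) K n).subtype

/-- The pairs `(α, β)` of degrees `b` and `a` map onto this graded piece, and the `+ 1` is the
Koszul relation `(H', -H)` in the kernel. -/
theorem finrank_spanPairDegree_le {H H' : MvPolynomial (Fin 3) K} {a b : ℕ}
    (hH : H.IsHomogeneous a) (hH' : H'.IsHomogeneous b) (h0 : H * H' ≠ 0) :
    Module.finrank K (spanPairDegree H H' (a + b)) + 1 ≤ (b + 2).choose 2 + (a + 2).choose 2 := by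
  let V := homogeneousSubmodule (Fin 3) K b
  let W := homogeneousSubmodule (Fin 3) K a
  let T : (V × W) →ₗ[K] MvPolynomial (Fin 3) K :=
    ((LinearMap.mulRight K H).comp V.subtype).coprod ((LinearMap.mulRight K H').comp W.subtype)
  have hT : ∀ x, T x = x.1 * H + x.2 * H' := fun _ => rfl
  have hker : 0 < Module.finrank K (LinearMap.ker T) := by
    refine (Module.finrank_pos_iff_exists_ne_zero (R := K) (M := LinearMap.ker T)).mpr ⟨⟨(⟨H', hH'⟩, ⟨-H, hH.neg⟩), ?_⟩, ?_⟩
    · rw [LinearMap.mem_ker, hT]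
      ring
    · intro h
      have := congrArg (fun x => (x.1.1 : MvPolynomial (Fin 3) K)) h
      exact right_ne_zero_of_mul h0 this
  have hle : (spanPairDegree H H' (a + b)).map (homogeneousSubmodule (Fin 3) K (a + b)).subtype ≤
      LinearMap.range T := by
    rintro _ ⟨G, hG, rfl⟩
    obtain ⟨α, β, hα, hβ, h⟩ := exists_isHomogeneous_of_mem_span hH hH' G.2 hG
    exact ⟨(⟨α, hα⟩, ⟨β, hβ⟩), h⟩
  have h1 := Submodule.finrank_mono hle
  rw [Submodule.finrank_map_subtype_eq] at h1
  have h2 := LinearMap.finrank_range_add_finrank_ker T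
  rw [Module.finrank_prod, finrank_homogeneousSubmodule, finrank_homogeneousSubmodule] at h2
  omega

/-- With the preceding bound, this says that `(H, H')` has codimension at least `ab` in degree `a +
b`. -/
theorem choose_two_identity (a b : ℕ) :
    (a + b + 2).choose 2 + 1 = (b + 2).choose 2 + (a + 2).choose 2 + a * b := by
  have key : ∀ n : ℕ, 2 * (n + 2).choose 2 = (n + 2) * (n + 1) := by
    intro n
    rw [Nat.choose_two_right, Nat.mul_div_cancel' (Nat.even_mul_pred_self _).two_dvd]
    rfl
  have h1 := key (a + b)
  have h2 := key a
  have h3 := key b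
  nlinarith

end Dimension

theorem finrank_le_sum_add_finrank_ker {K V ι : Type*} [Field K] [AddCommGroup V] [Module K V]
    [Module.Finite K V] (s : Finset ι) (M : ι → Type*) [∀ i, AddCommGroup (M i)]
    [∀ i, Module K (M i)] [∀ i, Module.Finite K (M i)] (Φ : ∀ i, V →ₗ[K] M i) (N : Submodule K V)
    (hN : ∀ v, (∀ i ∈ s, Φ i v = 0) → v ∈ N) :
    Module.finrank K V ≤ ∑ i ∈ s, Module.finrank K (M i) + Module.finrank K N := by
  let Ψ : V →ₗ[K] (∀ i : s, M i) := LinearMap.pi fun i => Φ i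
  have hker : LinearMap.ker Ψ ≤ N :=
    fun v hv => hN v fun i hi => congrFun (LinearMap.mem_ker.mp hv) ⟨i, hi⟩
  have h1 := LinearMap.finrank_range_add_finrank_ker Ψ
  have h2 := Submodule.finrank_mono hker
  have h3 := Submodule.finrank_le (LinearMap.range Ψ)
  rw [Module.finrank_pi_fintype, Finset.sum_coe_sort s (fun i => Module.finrank K (M i))] at h3
  omega

/-! ### Noether's `AF + BG` theorem and the Bézout bound -/

section Global

variable {K : Type u} [Field K]

theorem exists_eval_rep_eq (x : Fin 3 → K) (hx : x ≠ 0) : ∃ c : K, c ≠ 0 ∧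
    ∀ (n : ℕ) (G : MvPolynomial (Fin 3) K), G.IsHomogeneous n →
      eval (Projectivization.mk K x hx).rep G = c ^ n * eval x G := by
  obtain ⟨c, hc⟩ := Projectivization.exists_smul_eq_mk_rep K x hx
  refine ⟨c, c.ne_zero, fun n G hG => ?_⟩
  rw [← hc, ← coe_aeval_eq_eval, ← coe_aeval_eq_eval]
  exact aeval_smul_of_isHomogeneous hG (c : K) x

/-- The ideal `J` of all `T` with `T * G ∈ (H, H')` contains `H`, `H'` and, for each common zero, a
form not vanishing there. Its only possible zero is the origin, so a power of the linear form lies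
in `J`, and its factors cancel one at a time. -/
theorem mem_span_of_local [IsAlgClosed K] {H H' G : MvPolynomial (Fin 3) K} {a b N : ℕ}
    (hH : H.IsHomogeneous a) (hH' : H'.IsHomogeneous b) (hG : G.IsHomogeneous N)
    {z : Fin 3 → K} {i : Fin 3} (hz : z i ≠ 0)
    (hHH' : ∀ x ≠ 0, eval x H = 0 → eval x H' = 0 → eval x (linearForm z) ≠ 0)
    (hloc : ∀ P : ℙ K (Fin 3 → K), eval P.rep H = 0 → eval P.rep H' = 0 →
      algebraMap _ (Localization.AtPrime (originIdeal K)) (standardChart P.rep (chartIndex P) G) ∈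
      Ideal.span {algebraMap _ (Localization.AtPrime (originIdeal K))
          (standardChart P.rep (chartIndex P) H),
        algebraMap _ (Localization.AtPrime (originIdeal K))
          (standardChart P.rep (chartIndex P) H')}) :
    G ∈ Ideal.span {H, H'} := by
  let J : Ideal (MvPolynomial (Fin 3) K) :=
    Submodule.comap (LinearMap.toSpanSingleton _ _ G) (Ideal.span {H, H'})
  have hJ : ∀ T, T ∈ J ↔ T * G ∈ Ideal.span {H, H'} := fun _ => Iff.rfl
  have hrad : linearForm z ∈ J.radical := by
    rw [← vanishingIdeal_zeroLocus_eq_radical (K := K), mem_vanishingIdeal_iff]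
    intro x hx
    have hmem : ∀ p ∈ J, eval x p = 0 := fun p hp => hx p hp
    by_cases hx0 : x = 0
    · subst hx0
      exact (eval_linearForm z 0).trans (by simp)
    exfalso
    obtain ⟨c, hc, hrep⟩ := exists_eval_rep_eq x hx0
    have hHx : eval x H = 0 := hmem H ((hJ H).mpr (Ideal.mul_mem_right _ _ (Ideal.subset_span (by simp))))
    have hHx' : eval x H' = 0 := hmem H' ((hJ H').mpr (Ideal.mul_mem_right _ _ (Ideal.subset_span (by simp))))
    obtain ⟨m, T, hT, hT0, hTG⟩ := exists_mul_mem_span_of_local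
      (Classical.choose_spec (exists_rep_ne_zero (Projectivization.mk K x hx0))) hH hH' hG
      (hloc _ (by rw [hrep a H hH, hHx, mul_zero]) (by rw [hrep b H' hH', hHx', mul_zero]))
    rw [hrep m T hT, hmem T ((hJ T).mpr hTG), mul_zero] at hT0
    exact hT0 rfl
  obtain ⟨n, hn⟩ := hrad
  rw [hJ] at hn
  induction n with
  | zero => simpa using hn
  | succ n ih =>
    rw [pow_succ', mul_assoc] at hn
    exact ih (mem_span_of_linearForm_mul_mem z i hz hHH' hn)

theorem exists_linearForm_ne_zero [Infinite K] (s : Set (ℙ K (Fin 3 → K))) (hs : s.Finite) :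
    ∃ z : Fin 3 → K, z ≠ 0 ∧ ∀ P ∈ s, eval P.rep (linearForm z) ≠ 0 := by
  -- The factor `X 0` guarantees `z ≠ 0` even when `s` is empty.
  have h1 : X 0 * ∏ P ∈ hs.toFinset, linearForm P.rep ≠ 0 := by
    refine mul_ne_zero (X_ne_zero 0) (Finset.prod_ne_zero_iff.mpr fun P _ h => ?_)
    obtain ⟨i, hi⟩ := exists_rep_ne_zero P
    have h1 := eval_linearForm P.rep (Pi.single i 1)
    rw [h, map_zero] at h1
    exact hi (by simpa [Pi.single_apply] using h1.symm)
  obtain ⟨z, hz⟩ : ∃ z, eval z (X 0 * ∏ P ∈ hs.toFinset, linearForm P.rep) ≠ 0 := by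
    by_contra! h
    exact h1 (MvPolynomial.funext fun x => (h x).trans (map_zero _).symm)
  rw [map_mul, map_prod, eval_X] at hz
  refine ⟨z, fun h => left_ne_zero_of_mul hz (by rw [h]; rfl), fun P hP => ?_⟩
  have := Finset.prod_ne_zero_iff.mp (right_ne_zero_of_mul hz) P (hs.mem_toFinset.mpr hP)
  rw [eval_linearForm] at this ⊢
  simpa only [mul_comm] using this

/-- The local intersection ring of `V(H)` and `V(H')` at `P`. -/
abbrev LocalIntersection (H H' : MvPolynomial (Fin 3) K) (P : ℙ K (Fin 3 → K)) : Type u :=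
  Localization.AtPrime (originIdeal K) ⧸
    Ideal.span {algebraMap _ (Localization.AtPrime (originIdeal K))
        (standardChart P.rep (chartIndex P) H),
      algebraMap _ (Localization.AtPrime (originIdeal K)) (standardChart P.rep (chartIndex P) H')}

theorem toENat_rank_localIntersection_le_delta {H H' : MvPolynomial (Fin 3) K} {a b : ℕ}
    (hH : H.IsHomogeneous a) (hH' : H'.IsHomogeneous b) (h0 : H * H' ≠ 0) (P : ℙ K (Fin 3 → K)) :
    Cardinal.toENat (Module.rank K (LocalIntersection H H' P)) ≤ delta (H * H') P := by
  have h1 : chartEquation (H * H') P.rep (Pi.single (chartIndex P + 1) 1)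
      (Pi.single (chartIndex P + 2) 1) =
      standardChart P.rep (chartIndex P) H * standardChart P.rep (chartIndex P) H' :=
    map_mul (standardChart P.rep (chartIndex P)) H H'
  have hP : P.rep (chartIndex P) ≠ 0 := Classical.choose_spec (exists_rep_ne_zero P)
  rw [delta, h1]
  exact toENat_rank_le_localDelta (mul_ne_zero
    (standardChart_ne_zero hP hH (left_ne_zero_of_mul h0))
    (standardChart_ne_zero hP hH' (right_ne_zero_of_mul h0)))

theorem one_le_delta {H H' : MvPolynomial (Fin 3) K} {a b : ℕ}
    (hH : H.IsHomogeneous a) (hH' : H'.IsHomogeneous b) (h0 : H * H' ≠ 0) {P : ℙ K (Fin 3 → K)}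
    (hP : eval P.rep H = 0) (hP' : eval P.rep H' = 0) : 1 ≤ delta (H * H') P := by
  refine le_trans ?_ (toENat_rank_localIntersection_le_delta hH hH' h0 P)
  have : Nontrivial (LocalIntersection H H' P) := by
    refine Ideal.Quotient.nontrivial_iff.mpr fun htop => ?_
    have hle : Ideal.span {algebraMap _ (Localization.AtPrime (originIdeal K))
        (standardChart P.rep (chartIndex P) H),
        algebraMap _ (Localization.AtPrime (originIdeal K))
          (standardChart P.rep (chartIndex P) H')} ≤
        IsLocalRing.maximalIdeal (Localization.AtPrime (originIdeal K)) := by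
      rw [Ideal.span_le]
      rintro x (rfl | rfl) <;>
      · rw [SetLike.mem_coe, IsLocalRing.mem_maximalIdeal, mem_nonunits_iff,
          isUnit_algebraMap_originLocalization_iff, constantCoeff_standardChart]
        simpa
    rw [htop] at hle
    exact IsLocalRing.maximalIdeal.isMaximal _ |>.ne_top (top_le_iff.mp hle)
  have h1 : (1 : Cardinal) ≤ Module.rank K (LocalIntersection H H' P) := by
    rw [Cardinal.one_le_iff_pos]
    exact rank_pos
  simpa using OrderHomClass.mono Cardinal.toENat h1

/-- The common zeros of two forms. -/
def commonZeros (H H' : MvPolynomial (Fin 3) K) : Set (ℙ K (Fin 3 → K)) :=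
  {P | eval P.rep H = 0 ∧ eval P.rep H' = 0}

theorem finite_commonZeros {H H' : MvPolynomial (Fin 3) K} {a b : ℕ}
    (hH : H.IsHomogeneous a) (hH' : H'.IsHomogeneous b) (h0 : H * H' ≠ 0)
    (hfin : totalDelta (H * H') ≠ ⊤) : (commonZeros H H').Finite := by
  by_contra hinf
  apply hfin
  rw [ENat.eq_top_iff_forall_ge]
  intro n
  obtain ⟨s, hs, hcard⟩ := Set.Infinite.exists_subset_card_eq hinf n
  refine le_trans ?_ (le_iSup (fun s : Finset (ℙ K (Fin 3 → K)) => ∑ P ∈ s, delta (H * H') P) s)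
  calc (n : ℕ∞) = ∑ P ∈ s, 1 := by simp [hcard]
    _ ≤ _ := Finset.sum_le_sum fun P hP => one_le_delta hH hH' h0 (hs hP).1 (hs hP).2

theorem exists_line_disjoint_commonZeros [IsAlgClosed K] {H H' : MvPolynomial (Fin 3) K} {a b : ℕ}
    (hH : H.IsHomogeneous a) (hH' : H'.IsHomogeneous b) (h0 : H * H' ≠ 0)
    (hfin : totalDelta (H * H') ≠ ⊤) : ∃ (z : Fin 3 → K) (i : Fin 3), z i ≠ 0 ∧
      ∀ x ≠ 0, eval x H = 0 → eval x H' = 0 → eval x (linearForm z) ≠ 0 := by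
  have : Infinite K := IsAlgClosed.instInfinite
  obtain ⟨z, hz, hzP⟩ := exists_linearForm_ne_zero _ (finite_commonZeros hH hH' h0 hfin)
  obtain ⟨i, hi⟩ := Function.ne_iff.mp hz
  refine ⟨z, i, hi, fun x hx h h' => ?_⟩
  obtain ⟨c, hc, hrep⟩ := exists_eval_rep_eq x hx
  have := hzP (Projectivization.mk K x hx)
    ⟨by rw [hrep a H hH, h, mul_zero], by rw [hrep b H' hH', h', mul_zero]⟩
  rw [hrep 1 _ (isHomogeneous_linearForm z)] at this
  exact right_ne_zero_of_mul this

/-- Finite δ excludes multiple components: on a line missing the common zeros, `H` would be coprime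
to itself, hence a unit, yet its restriction has no constant term. -/
theorem not_sq_dvd_of_totalDelta_ne_top [IsAlgClosed K] {H H' : MvPolynomial (Fin 3) K} {a b : ℕ}
    (hH : H.IsHomogeneous a) (hH' : H'.IsHomogeneous b) (h0 : H * H' ≠ 0)
    (hfin : totalDelta (H * H') ≠ ⊤) (ha : 0 < a) : ¬ H ∣ H' := by
  intro hdvd
  obtain ⟨z, i, hz, hHH'⟩ := exists_line_disjoint_commonZeros hH hH' h0 hfin
  have hrel := isRelPrime_lineRestriction z i hz hHH'
  have hu := hrel dvd_rfl (map_dvd _ hdvd)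
  have h1 := isHomogeneous_lineRestriction z i hH
  have h2 : constantCoeff (lineRestriction z i H) = 0 :=
    h1.coeff_eq_zero (by simpa using ha.ne)
  exact not_isUnit_zero (h2 ▸ hu.map constantCoeff)

/-- **Bézout bound** for the total delta invariant of a reducible curve. -/
theorem mul_le_totalDelta [IsAlgClosed K] {H H' : MvPolynomial (Fin 3) K} {a b : ℕ}
    (hH : H.IsHomogeneous a) (hH' : H'.IsHomogeneous b) (h0 : H * H' ≠ 0) :
    ((a * b : ℕ) : ℕ∞) ≤ totalDelta (H * H') := by
  by_cases hfin : totalDelta (H * H') = ⊤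
  · rw [hfin]; exact le_top
  have hV := finite_commonZeros hH hH' h0 hfin
  obtain ⟨z, i, hz, hHH'⟩ := exists_line_disjoint_commonZeros hH hH' h0 hfin
  have hsum := le_iSup (fun s : Finset (ℙ K (Fin 3 → K)) => ∑ P ∈ s, delta (H * H') P) hV.toFinset
  refine le_trans ?_ hsum
  have hfinrank : ∀ P, Module.Finite K (LocalIntersection H H' P) ∧
      (Module.finrank K (LocalIntersection H H' P) : ℕ∞) ≤ delta (H * H') P := by
    intro P
    have h1 := toENat_rank_localIntersection_le_delta hH hH' h0 P
    have h2 : delta (H * H') P ≠ ⊤ := by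
      have := le_iSup (fun s : Finset (ℙ K (Fin 3 → K)) => ∑ P ∈ s, delta (H * H') P) {P}
      rw [Finset.sum_singleton] at this
      exact ne_top_of_le_ne_top hfin this
    have h3 : Module.Finite K (LocalIntersection H H' P) := by
      rw [← Module.rank_lt_aleph0_iff]
      by_contra hge
      rw [not_lt, ← Cardinal.toENat_eq_top] at hge
      exact h2 (top_le_iff.mp (hge ▸ h1))
    refine ⟨h3, ?_⟩
    rw [← Module.finrank_eq_rank, Cardinal.toENat_nat] at h1
    exact h1
  have := fun P => (hfinrank P).1
  refine le_trans ?_ (Finset.sum_le_sum fun P _ => (hfinrank P).2)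
  rw [← Nat.cast_sum, Nat.cast_le]
  let Φ : ∀ P, homogeneousSubmodule (Fin 3) K (a + b) →ₗ[K] LocalIntersection H H' P :=
    fun P => ((Ideal.Quotient.mkₐ K _).comp ((IsScalarTower.toAlgHom K
      (MvPolynomial (Fin 2) K) (Localization.AtPrime (originIdeal K))).comp
        (standardChart P.rep (chartIndex P)))).toLinearMap.comp (Submodule.subtype _)
  -- Forms of degree `a + b` vanishing in all local intersection rings lie in `(H, H')`, so the
  -- codimension of this ideal is at most the sum of the local dimensions.
  have h1 := finrank_le_sum_add_finrank_ker hV.toFinset (LocalIntersection H H') Φ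
    (spanPairDegree H H' (a + b)) (fun G hG =>
      mem_span_of_local hH hH' G.2 hz hHH' fun P hP hP' =>
        Ideal.Quotient.eq_zero_iff_mem.mp (hG P (hV.mem_toFinset.mpr ⟨hP, hP'⟩)))
  have h4 := finrank_spanPairDegree_le hH hH' h0
  have h5 := choose_two_identity a b
  rw [finrank_homogeneousSubmodule] at h1
  omega

end Global

/-! ### Descent of factors from the algebraic closure -/

section CoeffMap

variable {σ A B : Type*} [CommRing A] [CommRing B]

/-- Apply an additive map to all coefficients of a polynomial. -/
noncomputable def coeffMap (f : A →+ B) (p : MvPolynomial σ A) : MvPolynomial σ B :=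
  ∑ d ∈ p.support, monomial d (f (coeff d p))

theorem coeff_coeffMap (f : A →+ B) (p : MvPolynomial σ A) (d : σ →₀ ℕ) :
    coeff d (coeffMap f p) = f (coeff d p) := by
  classical
  rw [coeffMap, coeff_sum]
  simp_rw [coeff_monomial]
  rw [Finset.sum_ite_eq']
  split_ifs with h
  · rfl
  · rw [notMem_support_iff.mp h, map_zero]

theorem coeffMap_isHomogeneous (f : A →+ B) {p : MvPolynomial σ A} {n : ℕ} (hp : p.IsHomogeneous n) :
    (coeffMap f p).IsHomogeneous n := by
  intro d hd
  rw [coeff_coeffMap] at hd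
  exact hp fun h => hd (by rw [h, map_zero])

theorem coeffMap_map_mul [Algebra A B] (f : B →ₗ[A] A) (p : MvPolynomial σ A) (q : MvPolynomial σ B) :
    coeffMap f.toAddMonoidHom (map (algebraMap A B) p * q) = p * coeffMap f.toAddMonoidHom q := by
  classical
  ext d
  rw [coeff_coeffMap, coeff_mul, coeff_mul, map_sum]
  refine Finset.sum_congr rfl fun x _ => ?_
  rw [coeff_coeffMap, coeff_map, ← Algebra.smul_def]
  exact map_smul f _ _

theorem coeffMap_map [Algebra A B] {f : B →ₗ[A] A} (hf : f 1 = 1) (p : MvPolynomial σ A) :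
    coeffMap f.toAddMonoidHom (map (algebraMap A B) p) = p := by
  ext d
  rw [coeff_coeffMap, coeff_map, Algebra.algebraMap_eq_smul_one]
  exact (map_smul f _ _).trans (by rw [hf, smul_eq_mul, mul_one])

theorem coeffMap_derivation_mul {R : Type*} [CommRing R] [Algebra R A] (D : Derivation R A A)
    (p q : MvPolynomial σ A) :
    coeffMap (D : A →+ A) (p * q) =
      p * coeffMap (D : A →+ A) q + q * coeffMap (D : A →+ A) p := by
  classical
  ext d
  rw [coeff_coeffMap, coeff_mul, coeff_add, mul_comm q, coeff_mul, coeff_mul, map_sum,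
    ← Finset.sum_add_distrib]
  refine Finset.sum_congr rfl fun x _ => ?_
  rw [coeff_coeffMap, coeff_coeffMap]
  exact (D.leibniz _ _).trans (congrArg₂ _ rfl (mul_comm _ _))

end CoeffMap

section Descent

theorem exists_linearMap_one_eq_one (E L : Type*) [Field E] [Field L] [Algebra E L] :
    ∃ f : L →ₗ[E] E, f 1 = 1 := by
  obtain ⟨f, hf⟩ := LinearMap.exists_leftInverse_of_injective (Algebra.linearMap E L)
    (LinearMap.ker_eq_bot.mpr (algebraMap E L).injective)
  refine ⟨f, ?_⟩
  have := LinearMap.congr_fun hf 1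
  simpa using this

/-- An `E`-linear retraction `L → E`, applied to the coefficients of the cofactor, brings the
factorization down to `E`. -/
theorem exists_eq_mul_of_map_eq_mul {E L σ : Type*} [Field E] [Field L] [Algebra E L]
    {F Q : MvPolynomial σ E} {M : MvPolynomial σ L} (hQ : Q ≠ 0)
    (h : map (algebraMap E L) F = map (algebraMap E L) Q * M) :
    ∃ N, F = Q * N ∧ M = map (algebraMap E L) N := by
  obtain ⟨f, hf⟩ := exists_linearMap_one_eq_one E L
  have h1 : F = Q * coeffMap f.toAddMonoidHom M := by
    rw [← coeffMap_map_mul, ← h, coeffMap_map hf]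
  refine ⟨_, h1, ?_⟩
  have hinj := map_injective (σ := σ) (algebraMap E L) (algebraMap E L).injective
  apply mul_left_cancel₀ ((map_ne_zero_iff _ hinj).mpr hQ)
  rw [← h, ← map_mul, ← h1]

/-- The minimal polynomial has as many roots as its degree, and all are conjugates of `t`; hence
there is just one. -/
theorem mem_range_algebraMap_of_isSeparable {k L : Type*} [Field k] [Field L] [Algebra k L]
    [IsAlgClosed L] [Normal k L] {t : L} (ht : IsSeparable k t)
    (hfix : ∀ s : L ≃ₐ[k] L, s t = t) : t ∈ Set.range (algebraMap k L) := by
  have hint : IsIntegral k t := Normal.isIntegral inferInstance t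
  rw [← RingHom.coe_range, SetLike.mem_coe, ← minpoly.natDegree_eq_one_iff]
  rw [← Polynomial.card_rootSet_eq_natDegree (K := L) ht (IsAlgClosed.splits _)]
  rw [Fintype.card_eq_one_iff]
  refine ⟨⟨t, (Polynomial.mem_rootSet_of_ne (minpoly.ne_zero hint)).mpr (minpoly.aeval k t)⟩, ?_⟩
  rintro ⟨s, hs⟩
  rw [Polynomial.mem_rootSet_of_ne (minpoly.ne_zero hint)] at hs
  obtain ⟨τ, hτ⟩ := minpoly.exists_algEquiv_of_root' hint.isAlgebraic hs
  exact Subtype.ext (hτ.symm.trans (hfix τ))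

theorem isSeparable_of_forall_derivation_eq_zero {k E : Type u} [Field k] [Field E] [Algebra k E]
    [Module.Finite k E] (h : ∀ D : Derivation k E E, D = 0) : Algebra.IsSeparable k E := by
  rw [← Algebra.FormallyUnramified.iff_isSeparable]
  rw [Algebra.formallyUnramified_iff]
  have hD : ∀ x, KaehlerDifferential.D k E x = 0 := fun x =>
    (Module.forall_dual_apply_eq_zero_iff E _).mp fun f =>
      Derivation.congr_fun (h (f.compDer (KaehlerDifferential.D k E))) x
  rw [← Submodule.subsingleton_iff E, ← subsingleton_iff_bot_eq_top,
    ← KaehlerDifferential.span_range_derivation, eq_comm, Submodule.span_eq_bot]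
  rintro _ ⟨x, rfl⟩
  exact hD x

/-- Let `E` be generated by the coefficients of `Q`, and write `F = QN` over `E`. A `k`-derivation
`D` of `E`, acting on coefficients, kills `F`, so `Q` divides `N * DQ`, hence `DQ`. Thus `DQ` is a
constant multiple of `Q`, and the coefficient `1`, killed by `D`, makes that constant zero. All
derivations vanish and `E/k` is separable. -/
theorem isSeparable_coeff_of_irreducible_of_not_dvd {k L : Type u} {σ : Type*} [Field k] [Field L] [Algebra k L]
    [Algebra.IsAlgebraic k L] {F : MvPolynomial σ k} {Q M : MvPolynomial σ L} {e : ℕ} {d₀ : σ →₀ ℕ}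
    (hQ : Irreducible Q) (hQe : Q.IsHomogeneous e) (hd₀ : coeff d₀ Q = 1)
    (hF : map (algebraMap k L) F = Q * M) (hM : ¬ Q ∣ M) (d : σ →₀ ℕ) :
    IsSeparable k (coeff d Q) := by
  classical
  let E := IntermediateField.adjoin k (Q.coeffs : Set L)
  have hcoeff : ∀ d, coeff d Q ∈ E := by
    intro d
    by_cases h : coeff d Q = 0
    · rw [h]; exact zero_mem _
    · exact IntermediateField.subset_adjoin _ _ (coeff_mem_coeffs d h)
  have : Module.Finite k E := IntermediateField.finiteDimensional_adjoin
    fun x _ => (Algebra.IsAlgebraic.isAlgebraic (R := k) x).isIntegral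
  obtain ⟨Q', hQ'⟩ : ∃ Q' : MvPolynomial σ E, map (algebraMap E L) Q' = Q := by
    refine ⟨∑ d ∈ Q.support, monomial d ⟨coeff d Q, hcoeff d⟩, ?_⟩
    conv_rhs => rw [Q.as_sum]
    simp [map_sum, map_monomial]
  have hinj := map_injective (σ := σ) (algebraMap E L) (algebraMap E L).injective
  have hQ0 : Q' ≠ 0 := by
    rintro rfl
    exact hQ.ne_zero (hQ'.symm.trans (map_zero _))
  rw [IsScalarTower.algebraMap_eq k E L, ← MvPolynomial.map_map, ← hQ'] at hF
  obtain ⟨N, hN, rfl⟩ := exists_eq_mul_of_map_eq_mul hQ0 hF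
  have hQe' : Q'.IsHomogeneous e 
    := by
    rw [← hQ'] at hQe
    exact hQe.of_map (algebraMap E L).injective
  have hd₀' : coeff d₀ Q' = 1 := by
    apply (algebraMap E L).injective
    rw [← coeff_map, hQ', hd₀, map_one]
  have hsep : Algebra.IsSeparable k E := by
    refine isSeparable_of_forall_derivation_eq_zero fun D => ?_
    let DQ := coeffMap (D : E →+ E) Q'
    have h0 : coeffMap (D : E →+ E) (map (algebraMap k E) F) = 0 := by
      refine MvPolynomial.ext _ _ fun d => ?_
      rw [coeff_coeffMap, coeff_map, coeff_zero]
      exact D.map_algebraMap _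
    rw [hN, coeffMap_derivation_mul] at h0
    have hdvd : Q ∣ map (algebraMap E L) N * map (algebraMap E L) DQ := by
      rw [← map_mul, ← hQ']
      exact map_dvd _ ⟨- coeffMap (D : E →+ E) N, by linear_combination h0⟩
    have hDQ : DQ = 0 := by
      rcases hQ.prime.dvd_or_dvd hdvd with h | ⟨c, hc⟩
      · exact absurd h hM
      by_contra hne
      have hne' := (map_ne_zero_iff _ hinj).mpr hne
      have h1 := congrArg totalDegree hc
      have hc0 : c ≠ 0 := by
        rintro rfl
        exact hne' (by rw [hc, mul_zero])
      rw [totalDegree_mul_of_isDomain hQ.ne_zero hc0, hQe.totalDegree hQ.ne_zero,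
        ((coeffMap_isHomogeneous _ hQe').map _).totalDegree hne'] at h1
      rw [totalDegree_eq_zero_iff_eq_C.mp (by omega : c.totalDegree = 0)] at hc
      have h2 := congrArg (coeff d₀) hc
      rw [mul_comm, coeff_C_mul, hd₀, coeff_map, coeff_coeffMap, hd₀'] at h2
      have h3 : (D : E →+ E) 1 = 0 := D.map_one_eq_zero
      rw [h3, map_zero, mul_one] at h2
      rw [← h2, C_0, mul_zero] at hc
      exact hne' hc
    have hzero : ∀ (x : L) (hx : x ∈ E), D ⟨x, hx⟩ = 0 := by
      intro x hx
      induction hx using IntermediateField.adjoin_induction with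
      | mem x hx =>
        obtain ⟨d, -, rfl⟩ := mem_coeffs_iff.mp hx
        have := congrArg (coeff d) hDQ
        rw [coeff_coeffMap, coeff_zero] at this
        have h1 : coeff d (map (algebraMap E L) Q') = algebraMap E L (coeff d Q') := coeff_map _ _ _
        rw [hQ'] at h1
        exact (congrArg D (Subtype.ext h1)).trans this
      | algebraMap x => exact D.map_algebraMap x
      | add x y hx hy ihx ihy =>
        have := D.map_add ⟨x, hx⟩ ⟨y, hy⟩
        rw [ihx, ihy, add_zero] at this
        exact this
      | inv x hx ih =>
        have := D.leibniz_inv ⟨x, hx⟩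
        rw [ih, smul_zero] at this
        exact this
      | mul x y hx hy ihx ihy =>
        have := D.leibniz ⟨x, hx⟩ ⟨y, hy⟩
        rw [ihx, ihy, smul_zero, smul_zero, add_zero] at this
        exact this
    exact Derivation.ext fun x => hzero x.1 x.2
  have h1 := Algebra.IsSeparable.isSeparable k (coeff d Q')
  rw [← hQ', coeff_map]
  rwa [IsSeparable, minpoly.algebraMap_eq (algebraMap E L).injective]

theorem exists_map_eq_or_exists_conjugate_ne {k L : Type u} {σ : Type*} [Field k] [Field L]
    [Algebra k L] [IsAlgClosed L] [Normal k L] {F : MvPolynomial σ k} {Q M : MvPolynomial σ L}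
    {e : ℕ} {d₀ : σ →₀ ℕ} (hQ : Irreducible Q) (hQe : Q.IsHomogeneous e) (hd₀ : coeff d₀ Q = 1)
    (hF : map (algebraMap k L) F = Q * M) (hM : ¬ Q ∣ M) :
    (∃ G, map (algebraMap k L) G = Q) ∨ ∃ s : L ≃ₐ[k] L, map (s : L →+* L) Q ≠ Q := by
  refine or_iff_not_imp_right.mpr fun h => ?_
  push Not at h
  have hrange : ∀ d, ∃ a, algebraMap k L a = coeff d Q := fun d =>
    mem_range_algebraMap_of_isSeparable
      (isSeparable_coeff_of_irreducible_of_not_dvd hQ hQe hd₀ hF hM d)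
      fun s => by
        conv_rhs => rw [← h s, coeff_map]
        rfl
  choose a ha using hrange
  refine ⟨∑ d ∈ Q.support, monomial d (a d), ?_⟩
  conv_rhs => rw [Q.as_sum]
  simp [map_sum, map_monomial, ha]

end Descent

/-! ### Linear forms and rational points -/

section LinearForms

variable {K : Type*} [Field K]

theorem irreducible_of_isHomogeneous_one {σ : Type*} {G : MvPolynomial σ K}
    (hG : G.IsHomogeneous 1) (h0 : G ≠ 0) : Irreducible G := by
  refine irreducible_of_totalDegree_eq_one (hG.totalDegree h0) fun x hx => ?_
  rw [isUnit_iff_ne_zero]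
  rintro rfl
  exact h0 (MvPolynomial.ext _ _ fun d => zero_dvd_iff.mp (hx d))

theorem exists_eq_linearForm {G : MvPolynomial (Fin 3) K} (hG : G.IsHomogeneous 1) :
    ∃ z, G = linearForm z := by
  have h : G ∈ homogeneousSubmodule (Fin 3) K 1 := hG
  rw [homogeneousSubmodule_one_eq_span_X, Submodule.mem_span_range_iff_exists_fun] at h
  obtain ⟨c, rfl⟩ := h
  exact ⟨c, by simp [linearForm, smul_eq_C_mul]⟩

theorem dvd_of_eval_eq_zero {α β : K} (hαβ : α ≠ 0 ∨ β ≠ 0) {η : MvPolynomial (Fin 2) K} {n : ℕ}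
    (hη : η.IsHomogeneous n) (h : eval ![β, -α] η = 0) : C α * X 0 + C β * X 1 ∣ η := by
  let I := Ideal.span {(C α * X 0 + C β * X 1 : MvPolynomial (Fin 2) K)}
  have hcongr : ∀ x y : Fin 2 → MvPolynomial (Fin 2) K,
      (∀ j, Ideal.Quotient.mkₐ K I (x j) = Ideal.Quotient.mkₐ K I (y j)) →
      Ideal.Quotient.mkₐ K I (aeval x η) = Ideal.Quotient.mkₐ K I (aeval y η) := by
    intro x y hxy
    rw [← AlgHom.comp_apply, ← AlgHom.comp_apply]
    congr 1
    apply MvPolynomial.algHom_ext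
    simpa using hxy
  have hev : aeval (fun j => (C (![β, -α] j) : MvPolynomial (Fin 2) K)) η = 0 := by
    have h1 : (aeval (fun j => (C (![β, -α] j) : MvPolynomial (Fin 2) K))) =
        (Algebra.ofId K (MvPolynomial (Fin 2) K)).comp (aeval ![β, -α]) := by
      apply MvPolynomial.algHom_ext
      intro j
      simp [Algebra.ofId_apply, algebraMap_eq]
    rw [h1, AlgHom.comp_apply, show aeval ![β, -α] η = 0 from h, map_zero]
  -- Modulo the linear form, `c * (X 0, X 1)` is `y` times the point `(β, -α)`. By homogeneity `c ^
  -- n * η` is then a multiple of the value of `η` at that point, which is zero.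
  have key : ∀ (c : K) (y : MvPolynomial (Fin 2) K),
      (∀ j, Ideal.Quotient.mkₐ K I (C c * X j) = Ideal.Quotient.mkₐ K I (y * C (![β, -α] j))) →
      c ≠ 0 → C α * X 0 + C β * X 1 ∣ η := by
    intro c y hy hc
    have h1 := hcongr _ _ hy
    rw [aeval_smul_of_isHomogeneous hη, aeval_smul_of_isHomogeneous hη, hev, mul_zero, map_zero,
      aeval_X_left_apply] at h1
    have h2 := Ideal.mem_span_singleton.mp (Ideal.Quotient.eq_zero_iff_mem.mp h1)
    rw [← C_pow] at h2
    exact (IsUnit.dvd_mul_left ((isUnit_iff_ne_zero.mpr (pow_ne_zero n hc)).map C)).mp h2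
  rcases hαβ with hα | hβ
  · refine key α (-X 1) (fun j => ?_) hα
    refine Ideal.Quotient.eq.mpr (Ideal.mem_span_singleton.mpr ?_)
    fin_cases j
    · exact ⟨1, by simp; ring⟩
    · exact ⟨0, by simp; ring⟩
  · refine key β (X 0) (fun j => ?_) hβ
    refine Ideal.Quotient.eq.mpr (Ideal.mem_span_singleton.mpr ?_)
    fin_cases j
    · exact ⟨0, by simp; ring⟩
    · exact ⟨1, by simp; ring⟩

end LinearForms

section Rational

variable {k : Type u} [Field k]

/-- A vector over `k` regarded as a vector over the algebraic closure. -/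
noncomputable def geomPoint {ι : Type*} (v : ι → k) : ι → AlgebraicClosure k :=
  fun i => algebraMap k (AlgebraicClosure k) (v i)

theorem geomPoint_eq_zero_iff {ι : Type*} (v : ι → k) : geomPoint v = 0 ↔ v = 0 := by
  simp [geomPoint, funext_iff]

theorem geomPoint_crossProduct (v v' : Fin 3 → k) :
    geomPoint (crossProduct v v') = crossProduct (geomPoint v) (geomPoint v') := by
  ext i
  fin_cases i <;> simp [geomPoint, cross_apply]

theorem geom_linearForm (n : Fin 3 → k) : geom (linearForm n) = linearForm (geomPoint n) := by
  simp [geom, linearForm, geomPoint]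

theorem geom_injective : Function.Injective (geom (k := k)) :=
  map_injective _ (algebraMap k (AlgebraicClosure k)).injective

theorem dvd_of_geom_dvd {G F : MvPolynomial (Fin 3) k} (hG : G ≠ 0) (h : geom G ∣ geom F) :
    G ∣ F := by
  obtain ⟨M, hM⟩ := h
  obtain ⟨N, hN, -⟩ := exists_eq_mul_of_map_eq_mul hG hM
  exact ⟨N, hN⟩

theorem containsLine_of_crossProduct_ne_zero {F : MvPolynomial (Fin 3) k}
    {z : Fin 3 → AlgebraicClosure k} (hz : z ≠ 0) (hF : linearForm z ∣ geom F)
    {v v' : Fin 3 → k} (hvv' : crossProduct v v' ≠ 0)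
    (hv : eval (geomPoint v) (linearForm z) = 0) (hv' : eval (geomPoint v') (linearForm z) = 0) :
    ContainsLine F := by
  set n := crossProduct v v' with hn
  have hn0 : geomPoint n ≠ 0 := (geomPoint_eq_zero_iff n).not.mpr hvv'
  -- This is `z × (v × v') = (z·v') v - (z·v) v'`: the line through two rational points has
  -- coefficients proportional to `v × v'`.
  have hcross : crossProduct z (geomPoint n) = 0 := by
    rw [hn, geomPoint_crossProduct]
    rw [eval_linearForm, Fin.sum_univ_three] at hv hv'
    ext i
    fin_cases i
    · simp [cross_apply]
      linear_combination geomPoint v 0 * hv' - geomPoint v' 0 * hv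
    · simp [cross_apply]
      linear_combination geomPoint v 1 * hv' - geomPoint v' 1 * hv
    · simp [cross_apply]
      linear_combination geomPoint v 2 * hv' - geomPoint v' 2 * hv
  have hdep : ¬ LinearIndependent (AlgebraicClosure k) ![z, geomPoint n] := by
    rw [← crossProduct_ne_zero_iff_linearIndependent]
    exact fun h => h hcross
  rw [LinearIndependent.pair_iff' hz] at hdep
  push Not at hdep
  obtain ⟨c, hc⟩ := hdep
  have hlin : linearForm (geomPoint n) = C c * linearForm z := by
    rw [← hc]
    simp [linearForm, Finset.mul_sum, mul_assoc]
  have hc0 : c ≠ 0 := by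
    rintro rfl
    rw [zero_smul] at hc
    exact hn0 hc.symm
  have hl0 : linearForm n ≠ 0 := by
    intro h
    apply hvv'
    ext i
    have h1 := eval_linearForm n (Pi.single i 1)
    rw [h, map_zero] at h1
    simpa [Pi.single_apply] using h1.symm
  refine ⟨linearForm n, hl0, isHomogeneous_linearForm n, dvd_of_geom_dvd hl0 ?_⟩
  rw [geom_linearForm, hlin]
  exact (IsUnit.mul_left_dvd ((isUnit_iff_ne_zero.mpr hc0).map C)).mpr hF

/-- By the product rule, a common zero of two factors is a singular point. -/
theorem exists_rational_point {F : MvPolynomial (Fin 3) k}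
    (hadm : HasOnlyAdmissibleSingularities F) {A B : MvPolynomial (Fin 3) (AlgebraicClosure k)}
    {a b : ℕ} (hA : A.IsHomogeneous a) (hB : B.IsHomogeneous b) (hF : geom F = A * B)
    {y : Fin 3 → AlgebraicClosure k} (hy : y ≠ 0) (hyA : eval y A = 0) (hyB : eval y B = 0) :
    ∃ (v : Fin 3 → k) (c : AlgebraicClosure k), c ≠ 0 ∧ geomPoint v = c • y ∧
      IsAdmissibleAt F v := by
  obtain ⟨c, hc, hrep⟩ := exists_eval_rep_eq y hy
  have hPA : eval (Projectivization.mk (AlgebraicClosure k) y hy).rep A = 0 := by rw [hrep a A hA, hyA, mul_zero]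
  have hPB : eval (Projectivization.mk (AlgebraicClosure k) y hy).rep B = 0 := by rw [hrep b B hB, hyB, mul_zero]
  have hsing : IsSingularAt (geom F) (Projectivization.mk (AlgebraicClosure k) y hy).rep := by
    rw [hF]
    refine ⟨by rw [map_mul, hPA, zero_mul], fun i => ?_⟩
    rw [Derivation.leibniz, smul_eq_mul, smul_eq_mul, map_add, map_mul, map_mul, hPA, hPB]
    ring
  obtain ⟨v, hv, hP, hadmv⟩ := hadm _ hsing
  rw [Projectivization.mk_eq_mk_iff] at hP
  obtain ⟨c, hc⟩ := hP
  refine ⟨v, (c⁻¹ : (AlgebraicClosure k)ˣ), Units.ne_zero _, ?_, hadmv⟩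
  rw [← hc]
  exact (inv_smul_smul c (geomPoint v)).symm

theorem geom_chartEquation (F : MvPolynomial (Fin 3) k) (v u w : Fin 3 → k) :
    map (algebraMap k (AlgebraicClosure k)) (chartEquation F v u w) =
      chartEquation (geom F) (geomPoint v) (geomPoint u) (geomPoint w) := by
  unfold chartEquation geom
  have : (map (algebraMap k (AlgebraicClosure k))).comp (aeval
      (fun i : Fin 3 => C (v i) + C (u i) * X (0 : Fin 2) + C (w i) * X (1 : Fin 2))).toRingHom =
      (aeval (fun i : Fin 3 => C (geomPoint v i) + C (geomPoint u i) * X (0 : Fin 2) +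
        C (geomPoint w i) * X (1 : Fin 2))).toRingHom.comp (map (algebraMap k (AlgebraicClosure k))) := by
    refine MvPolynomial.ringHom_ext (fun r => ?_) (fun i => ?_)
    · simp [algebraMap_eq]
    · simp [geomPoint]
  exact DFunLike.congr_fun this F

end Rational

/-! ### Local equations along a line, and cones -/

section Chart

variable {K : Type*} [Field K]

theorem coeff_aeval_X_mul_C (μ : MvPolynomial (Fin 2) K) (x : Fin 2 → K) (i : ℕ) :
    (aeval (fun j => Polynomial.X * Polynomial.C (x j)) μ).coeff i =
      eval x (homogeneousComponent i μ) := by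
  conv_lhs => rw [← sum_homogeneousComponent μ, map_sum, Polynomial.finsetSum_coeff]
  have h1 : ∀ n, (aeval (fun j => Polynomial.X * Polynomial.C (x j))
      (homogeneousComponent n μ)) = Polynomial.X ^ n * Polynomial.C (eval x (homogeneousComponent n μ)) := by
    intro n
    rw [aeval_smul_of_isHomogeneous (homogeneousComponent_isHomogeneous n μ)]
    congr 1
    have h2 : (aeval (fun j => Polynomial.C (x j))) =
        (Algebra.ofId K (Polynomial K)).comp (aeval x) := by
      apply MvPolynomial.algHom_ext
      intro j
      simp [Algebra.ofId_apply]
    rw [h2]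
    rfl
  simp_rw [h1, Polynomial.coeff_X_pow_mul', Polynomial.coeff_C]
  rw [Finset.sum_eq_single i]
  · simp
  · intro n _ hn
    split_ifs with h2 h3
    · omega
    · rfl
    · rfl
  · intro hi
    rw [homogeneousComponent_eq_zero i μ (by simpa using hi)]
    simp

theorem eval_aeval_eq {R : Type*} [CommRing R] [Algebra K R] (ψ : R →ₐ[K] K) (g : Fin 3 → R)
    (M : MvPolynomial (Fin 3) K) : ψ (aeval g M) = eval (fun j => ψ (g j)) M := by
  have : ψ.comp (aeval g) = aeval (fun j => ψ (g j)) := by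
    apply MvPolynomial.algHom_ext
    simp
  exact DFunLike.congr_fun this M

/-- A form of degree `n` meeting the line at most at `v` has contact of order `n` there. Indeed
`M(sv + q)` has no root in `s`, so it is a constant `c`, and `M(v + tq) = c t ^ n`. -/
theorem coeff_aeval_line_eq [IsAlgClosed K] {M : MvPolynomial (Fin 3) K} {n : ℕ}
    (hM : M.IsHomogeneous n) (v q : Fin 3 → K) (h : ∀ s : K, eval (s • v + q) M ≠ 0) {i : ℕ}
    (hi : i ≠ n) :
    (aeval (fun j => Polynomial.C (v j) + Polynomial.X * Polynomial.C (q j)) M).coeff i = 0 := by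
  set p := aeval (fun j => Polynomial.C (v j) + Polynomial.X * Polynomial.C (q j)) M
  let r := aeval (fun j => Polynomial.X * Polynomial.C (v j) + Polynomial.C (q j)) M
  have hr : ∀ s, r.eval s = eval (s • v + q) M := by
    intro s
    have := eval_aeval_eq (Polynomial.aeval s)
      (fun j => Polynomial.X * Polynomial.C (v j) + Polynomial.C (q j)) M
    rw [Polynomial.coe_aeval_eq_eval] at this
    refine this.trans ?_
    congr 2
    ext j
    simp
    exact mul_comm _ _
  have hp : ∀ t, p.eval t = eval (v + t • q) M := by
    intro s
    have := eval_aeval_eq (Polynomial.aeval s)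
      (fun j => Polynomial.C (v j) + Polynomial.X * Polynomial.C (q j)) M
    rw [Polynomial.coe_aeval_eq_eval] at this
    refine this.trans ?_
    congr 2
    ext j
    simp
    exact mul_comm _ _
  have hdeg : r.degree = 0 := by
    by_contra hne
    obtain ⟨s, hs⟩ := IsAlgClosed.exists_root r hne
    exact h s ((hr s).symm.trans hs)
  obtain ⟨c, hc⟩ : ∃ c, r = Polynomial.C c := ⟨_, Polynomial.eq_C_of_degree_eq_zero hdeg⟩
  have hinf : Infinite K := IsAlgClosed.instInfinite
  -- The comparison with `s = 1/t` is available only for `t ≠ 0`; the factor `X` takes care of `t =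
  -- 0`.
  have hpX : Polynomial.X * p = Polynomial.X * (Polynomial.C c * Polynomial.X ^ n) := by
    refine Polynomial.funext fun t => ?_
    by_cases ht : t = 0
    · simp [ht]
    · have h1 : v + t • q = fun j => t * (t⁻¹ • v + q) j := by
        ext j
        simp [mul_add, ht]
      have h2 : eval (v + t • q) M = t ^ n * c := by
        rw [h1, ← coe_aeval_eq_eval]
        refine (aeval_smul_of_isHomogeneous hM t _).trans ?_
        congr 1
        exact (hr t⁻¹).symm.trans (by rw [hc, Polynomial.eval_C])
      rw [Polynomial.eval_mul, hp, h2]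
      simp only [Polynomial.eval_mul, Polynomial.eval_X, Polynomial.eval_C, Polynomial.eval_pow]
      ring
  rw [mul_left_cancel₀ Polynomial.X_ne_zero hpX, Polynomial.coeff_C_mul, Polynomial.coeff_X_pow,
    if_neg hi, mul_zero]

theorem chartEquation_mul (A B : MvPolynomial (Fin 3) K) (v u w : Fin 3 → K) :
    chartEquation (A * B) v u w = chartEquation A v u w * chartEquation B v u w :=
  map_mul _ A B

theorem chartEquation_linearForm (z v u w : Fin 3 → K) (hv : eval v (linearForm z) = 0) :
    chartEquation (linearForm z) v u w =
      C (eval u (linearForm z)) * X 0 + C (eval w (linearForm z)) * X 1 := by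
  have h1 : C (eval v (linearForm z)) = (0 : MvPolynomial (Fin 2) K) := by rw [hv, C_0]
  rw [eval_linearForm] at h1
  rw [eval_linearForm z u, eval_linearForm z w, chartEquation, linearForm]
  simp only [Fin.sum_univ_three, map_add, map_mul, aeval_X, algHom_C, algebraMap_eq] at h1 ⊢
  linear_combination h1

theorem eval_homogeneousComponent_chartEquation [IsAlgClosed K] {M : MvPolynomial (Fin 3) K} {n : ℕ}
    (hM : M.IsHomogeneous n) (v u w : Fin 3 → K) (α β : K)
    (h : ∀ s : K, eval (s • v + (β • u - α • w)) M ≠ 0) {i : ℕ} (hi : i ≠ n) :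
    eval ![β, -α] (homogeneousComponent i (chartEquation M v u w)) = 0 := by
  rw [← coeff_aeval_X_mul_C, ← coeff_aeval_line_eq hM v _ h hi]
  congr 1
  rw [chartEquation, ← AlgHom.comp_apply]
  congr 1
  apply MvPolynomial.algHom_ext
  intro j
  simp [algHom_C]
  ring

theorem not_dvd_of_prod_eq {ι : Type*} [Fintype ι] {l : ι → MvPolynomial (Fin 2) K}
    {lam η : MvPolynomial (Fin 2) K} (hl : ∀ j, IsLinearForm (l j))
    (hass : ∀ i j, i ≠ j → ¬ Associated (l i) (l j)) (hlam : Irreducible lam)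
    (h : ∏ j, l j = lam * η) : ¬ lam ∣ η := by
  classical
  intro hdvd
  have hirr : ∀ j, Irreducible (l j) := fun j => irreducible_of_isHomogeneous_one (hl j).1 (hl j).2
  obtain ⟨i, -, hi⟩ := hlam.prime.exists_mem_finset_dvd (h ▸ Dvd.intro _ rfl : lam ∣ ∏ j, l j)
  have hi' : Associated lam (l i) := (hlam.associated_of_dvd (hirr i) hi)
  obtain ⟨c, hc⟩ := hi'
  rw [← Finset.mul_prod_erase Finset.univ l (Finset.mem_univ i), ← hc, mul_assoc] at h
  have h1 := mul_left_cancel₀ hlam.ne_zero h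
  have h2 : lam ∣ ∏ j ∈ Finset.univ.erase i, l j := by
    rw [← (Units.isUnit c).dvd_mul_left, h1]
    exact hdvd
  obtain ⟨j, hj, hj'⟩ := hlam.prime.exists_mem_finset_dvd h2
  exact hass i j (Finset.ne_of_mem_erase hj).symm
    ((Associated.trans ⟨c, hc⟩ (Associated.refl _) : Associated lam (l i)).symm.trans
      (hlam.associated_of_dvd (hirr j) hj'))

theorem totalDegree_chartEquation_le {F : MvPolynomial (Fin 3) K} {n : ℕ} (hF : F.IsHomogeneous n)
    (v u w : Fin 3 → K) : (chartEquation F v u w).totalDegree ≤ n := by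
  rw [chartEquation, aeval_def, eval₂_eq]
  refine totalDegree_finsetSum_le fun d hd => ?_
  refine (totalDegree_mul _ _).trans ?_
  rw [algebraMap_eq, totalDegree_C, zero_add]
  refine (totalDegree_finsetProd _ _).trans ?_
  have hdeg : ∑ i ∈ d.support, d i = n := by
    rw [← Finsupp.degree_apply]
    by_contra h
    exact (mem_support_iff.mp hd) (hF.coeff_eq_zero h)
  rw [← hdeg]
  refine Finset.sum_le_sum fun i _ => (totalDegree_pow _ _).trans ?_
  have h1 : (C (v i) + C (u i) * X (0 : Fin 2) + C (w i) * X (1 : Fin 2)).totalDegree ≤ 1 := by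
    refine (totalDegree_add _ _).trans (max_le ((totalDegree_add _ _).trans (max_le ?_ ?_)) ?_)
    · simp
    · exact (isHomogeneous_C_mul_X _ _).totalDegree_le
    · exact (isHomogeneous_C_mul_X _ _).totalDegree_le
  simpa using Nat.mul_le_mul_left (d i) h1

theorem isHomogeneous_of_homogeneousComponent_eq_zero {σ : Type*} {p : MvPolynomial σ K} {n : ℕ}
    (hdeg : p.totalDegree ≤ n) (h : ∀ i < n, homogeneousComponent i p = 0) : p.IsHomogeneous n := by
  have h1 : homogeneousComponent n p = p := by
    conv_rhs => rw [← sum_homogeneousComponent p]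
    by_cases hlt : p.totalDegree < n
    · rw [homogeneousComponent_eq_zero n p hlt, Finset.sum_eq_zero]
      intro i hi
      exact h i (by simp at hi; omega)
    · have : p.totalDegree = n := by omega
      rw [this, Finset.sum_range_succ, Finset.sum_eq_zero, zero_add]
      intro i hi
      exact h i (by simpa using hi)
  rw [← h1]
  exact homogeneousComponent_isHomogeneous n p

theorem eval_chartEquation (F : MvPolynomial (Fin 3) K) (v u w : Fin 3 → K) (x : Fin 2 → K) :
    eval x (chartEquation F v u w) = eval (v + x 0 • u + x 1 • w) F := by
  refine (eval_aeval_eq (aeval x) _ F).trans ?_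
  congr 2
  ext j
  simp
  ring

/-- A curve of degree `n` with a point of multiplicity `n` is a cone. -/
theorem exists_eq_aeval_of_isHomogeneous_chartEquation [Infinite K] {F : MvPolynomial (Fin 3) K}
    {n : ℕ} (hF : F.IsHomogeneous n) {v u w : Fin 3 → K}
    (hD : dotProduct v (crossProduct u w) ≠ 0) (hφ : (chartEquation F v u w).IsHomogeneous n) :
    ∃ (c : K) (zB zC : Fin 3 → K), c ≠ 0 ∧
      F = C c * aeval ![linearForm zB, linearForm zC] (chartEquation F v u w) := by
  set φ := chartEquation F v u w
  set D := dotProduct v (crossProduct u w) with hDdef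
  let zA := crossProduct u w
  let zB := crossProduct w v
  let zC := crossProduct v u
  have hA0 : linearForm zA ≠ 0 := by
    intro h
    have h1 := eval_linearForm zA v
    rw [h, map_zero] at h1
    apply hD
    rw [h1, hDdef, dotProduct]
    simp [zA, mul_comm]
  -- The factor `linearForm zA` restricts the check to points of the chart around `v`.
  have key : linearForm zA * (C (D ^ n) * F) =
      linearForm zA * aeval ![linearForm zB, linearForm zC] φ := by
    refine MvPolynomial.funext fun y => ?_
    rw [map_mul, map_mul _ (linearForm zA)]
    by_cases hAy : eval y (linearForm zA) = 0
    · rw [hAy, zero_mul, zero_mul]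
    congr 1
    set a := eval y (linearForm zA) with ha
    set b := eval y (linearForm zB) with hb
    set c := eval y (linearForm zC) with hc
    -- Cramer's rule: `a`, `b`, `c` are `D` times the coordinates of `y` in the frame `(v, u, w)`.
    have hvec : ∀ j, D * y j = a * (v + (a⁻¹ * b) • u + (a⁻¹ * c) • w) j := by
      intro j
      simp only [Pi.add_apply, Pi.smul_apply, smul_eq_mul, mul_add]
      rw [← mul_assoc a, mul_inv_cancel_left₀ hAy, ← mul_assoc a, mul_inv_cancel_left₀ hAy]
      rw [ha, hb, hc, hDdef, eval_linearForm, eval_linearForm, eval_linearForm]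
      simp only [Fin.sum_univ_three, zA, zB, zC, cross_apply, dotProduct, Matrix.cons_val]
      fin_cases j <;> simp <;> ring
    have h1 : eval (fun j => D * y j) F = D ^ n * eval y F := by
      rw [← coe_aeval_eq_eval]
      exact aeval_smul_of_isHomogeneous hF D y
    have h2 : eval (fun j => a * (v + (a⁻¹ * b) • u + (a⁻¹ * c) • w) j) F =
        a ^ n * eval (v + (a⁻¹ * b) • u + (a⁻¹ * c) • w) F := by
      rw [← coe_aeval_eq_eval]
      exact aeval_smul_of_isHomogeneous hF a _
    have h3 : eval (v + (a⁻¹ * b) • u + (a⁻¹ * c) • w) F = eval (fun j => a⁻¹ * ![b, c] j) φ :=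
      (eval_chartEquation F v u w (fun j => a⁻¹ * ![b, c] j)).symm
    have h4 : eval (fun j => a⁻¹ * ![b, c] j) φ = a⁻¹ ^ n * eval ![b, c] φ := by
      rw [← coe_aeval_eq_eval]
      exact aeval_smul_of_isHomogeneous hφ a⁻¹ _
    have h5 : eval y (aeval ![linearForm zB, linearForm zC] φ) = eval ![b, c] φ := by
      have : (aeval y : MvPolynomial (Fin 3) K →ₐ[K] K).comp
          (aeval ![linearForm zB, linearForm zC]) = aeval ![b, c] := by
        apply MvPolynomial.algHom_ext
        intro j
        fin_cases j <;> simp [hb, hc, aeval_eq_eval]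
      exact DFunLike.congr_fun this φ
    rw [map_mul, eval_C, h5, ← h1, funext hvec, h2, h3, h4, ← mul_assoc, ← mul_pow,
      mul_inv_cancel₀ hAy, one_pow, one_mul]
  refine ⟨(D ^ n)⁻¹, zB, zC, inv_ne_zero (pow_ne_zero n hD), ?_⟩
  rw [← mul_left_cancel₀ hA0 key, ← mul_assoc, ← C_mul, inv_mul_cancel₀ (pow_ne_zero n hD), C_1,
    one_mul]

end Chart

section Frame

variable {K : Type*} [Field K]

theorem dotProduct_crossProduct_ne_zero {v u w : Fin 3 → K}
    (h : LinearIndependent K ![v, u, w]) : dotProduct v (crossProduct u w) ≠ 0 := by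
  rw [triple_product_eq_det]
  have h1 : LinearIndependent K (Matrix.of ![v, u, w]).row := h
  rw [Matrix.linearIndependent_rows_iff_isUnit, Matrix.isUnit_iff_isUnit_det] at h1
  exact h1.ne_zero

theorem crossProduct_frame_ne_zero {v u w : Fin 3 → K} (hD : dotProduct v (crossProduct u w) ≠ 0)
    {α β : K} (hαβ : α ≠ 0 ∨ β ≠ 0) : crossProduct v (β • u - α • w) ≠ 0 := by
  intro h
  have h1 : dotProduct w (crossProduct v (β • u - α • w)) =
      β * dotProduct v (crossProduct u w) := by
    simp [cross_apply, dotProduct, Fin.sum_univ_three]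
    ring
  have h2 : dotProduct u (crossProduct v (β • u - α • w)) =
      α * dotProduct v (crossProduct u w) := by
    simp [cross_apply, dotProduct, Fin.sum_univ_three]
    ring
  rw [h, dotProduct_zero, eq_comm, mul_eq_zero, or_iff_left hD] at h1 h2
  exact hαβ.elim (fun h => h h2) (fun h => h h1)

theorem eq_zero_of_dotProduct_frame {v u w z : Fin 3 → K}
    (hD : dotProduct v (crossProduct u w) ≠ 0) (hv : dotProduct z v = 0) (hu : dotProduct z u = 0)
    (hw : dotProduct z w = 0) : z = 0 := by
  ext j
  have h1 : dotProduct v (crossProduct u w) * z j = 0 := by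
    have : dotProduct v (crossProduct u w) * z j = dotProduct z v * crossProduct u w j +
        dotProduct z u * crossProduct w v j + dotProduct z w * crossProduct v u j := by
      fin_cases j <;> simp [cross_apply, dotProduct, Fin.sum_univ_three] <;> ring
    rw [this, hv, hu, hw]
    ring
  exact (mul_eq_zero.mp h1).resolve_left hD

theorem exists_zero_on_line [IsAlgClosed K] {z : Fin 3 → K} (hz : z ≠ 0)
    {M : MvPolynomial (Fin 3) K} {n : ℕ} (hM : M.IsHomogeneous n) (hn : 0 < n) :
    ∃ y ≠ 0, eval y (linearForm z) = 0 ∧ eval y M = 0 := by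
  by_contra! h
  obtain ⟨i, hi⟩ := Function.ne_iff.mp hz
  have hrel := isRelPrime_lineRestriction z i hi (H := M) (H' := M)
    fun x hx hxM _ hxz => h x hx hxz hxM
  have hu := hrel dvd_rfl dvd_rfl
  have h2 : constantCoeff (lineRestriction z i M) = 0 :=
    (isHomogeneous_lineRestriction z i hM).coeff_eq_zero (by simpa using hn.ne)
  exact not_isUnit_zero (h2 ▸ hu.map constantCoeff)

end Frame

/-! ### A line component is rational, unless the curve is a cone -/

section LineComponent

variable {k : Type u} [Field k]

theorem geomPoint_dotProduct (v v' : Fin 3 → k) :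
    dotProduct (geomPoint v) (geomPoint v') = algebraMap k (AlgebraicClosure k) (dotProduct v v') := by
  simp [geomPoint, dotProduct]

theorem map_homogeneousComponent {σ A B : Type*} [CommRing A] [CommRing B] (f : A →+* B)
    (p : MvPolynomial σ A) (n : ℕ) :
    map f (homogeneousComponent n p) = homogeneousComponent n (map f p) := by
  classical
  ext d
  rw [coeff_map, coeff_homogeneousComponent, coeff_homogeneousComponent, coeff_map]
  split_ifs <;> simp

/-- The line meets the residual curve `M` in singular, hence rational, points. A second such point
makes the line rational; otherwise the admissible type at the only point `v` decides. -/
theorem containsLine_or_cone {F : MvPolynomial (Fin 3) k} {n : ℕ} (hF : F.IsHomogeneous (n + 1))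
    (hn : 0 < n) (hadm : HasOnlyAdmissibleSingularities F) {z : Fin 3 → AlgebraicClosure k}
    (hz : z ≠ 0) {M : MvPolynomial (Fin 3) (AlgebraicClosure k)} (hM : M.IsHomogeneous n)
    (hFM : geom F = linearForm z * M) :
    ContainsLine F ∨ ∃ (c : AlgebraicClosure k)
      (l : Fin (n + 1) → MvPolynomial (Fin 3) (AlgebraicClosure k)),
      (∀ j, (l j).IsHomogeneous 1) ∧ geom F = C c * ∏ j, l j := by
  refine or_iff_not_imp_left.mpr fun hline => ?_
  have hdvd : linearForm z ∣ geom F := ⟨M, hFM⟩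
  obtain ⟨y, hy, hyz, hyM⟩ := exists_zero_on_line hz hM hn
  obtain ⟨v, c, hc, hvy, φ, ⟨u, w, hind, c₀, hc₀, hφ⟩, m, htype⟩ :=
    exists_rational_point hadm (isHomogeneous_linearForm z) hM hFM hy hyz hyM
  have hDk := dotProduct_crossProduct_ne_zero hind
  have hD : dotProduct (geomPoint v) (crossProduct (geomPoint u) (geomPoint w)) ≠ 0 := by
    rw [← geomPoint_crossProduct, geomPoint_dotProduct]
    exact (map_ne_zero _).mpr hDk
  have hev : ∀ x, eval x (linearForm z) = dotProduct z x := eval_linearForm z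
  have hzv : eval (geomPoint v) (linearForm z) = 0 := by
    rw [hev] at hyz ⊢
    rw [hvy, dotProduct_smul, hyz, smul_zero]
  set α := eval (geomPoint u) (linearForm z) with hα
  set β := eval (geomPoint w) (linearForm z) with hβ
  have hαβ : α ≠ 0 ∨ β ≠ 0 := by
    by_contra! h
    exact hz (eq_zero_of_dotProduct_frame hD (by rw [← hev, hzv]) (by rw [← hev, ← hα, h.1])
      (by rw [← hev, ← hβ, h.2]))
  -- The points `s v + q` are all points of the line other than `v`.
  set q := β • geomPoint u - α • geomPoint w with hq
  have hcross : crossProduct (geomPoint v) q ≠ 0 := crossProduct_frame_ne_zero hD hαβ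
  have hqz : eval q (linearForm z) = 0 := by
    rw [hev, hq, dotProduct_sub, dotProduct_smul, dotProduct_smul, ← hev, ← hev, ← hα, ← hβ]
    simp only [smul_eq_mul]
    ring
  have hnz : ∀ s : AlgebraicClosure k, eval (s • geomPoint v + q) M ≠ 0 := by
    intro s hs
    have hc1 : crossProduct (geomPoint v) (s • geomPoint v + q) = crossProduct (geomPoint v) q := by
      rw [map_add, map_smul, cross_self, smul_zero, zero_add]
    have hsz : eval (s • geomPoint v + q) (linearForm z) = 0 := by
      rw [hev] at hzv hqz ⊢
      rw [dotProduct_add, dotProduct_smul, hzv, hqz, smul_zero, add_zero]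
    have hs0 : s • geomPoint v + q ≠ 0 := by
      intro h0
      rw [h0, map_zero] at hc1
      exact hcross hc1.symm
    obtain ⟨v', c', hc', hv', -⟩ :=
      exists_rational_point hadm (isHomogeneous_linearForm z) hM hFM hs0 hsz hs
    refine hline (containsLine_of_crossProduct_ne_zero hz hdvd (v := v) (v' := v') ?_ hzv ?_)
    · rw [Ne, ← geomPoint_eq_zero_iff, geomPoint_crossProduct, hv', map_smul, hc1]
      exact smul_ne_zero hc' hcross
    · rw [hev] at hsz ⊢
      rw [hv', dotProduct_smul, hsz, smul_zero]
  set lam : MvPolynomial (Fin 2) (AlgebraicClosure k) := C α * X 0 + C β * X 1 with hlam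
  set μ := chartEquation M (geomPoint v) (geomPoint u) (geomPoint w) with hμ
  have hlam1 : lam.IsHomogeneous 1 := (isHomogeneous_C_mul_X _ _).add (isHomogeneous_C_mul_X _ _)
  have hlam0 : eval ![β, -α] lam = 0 := by
    simp [hlam]
    ring
  have hφμ : map (algebraMap k (AlgebraicClosure k)) φ =
      C (algebraMap k (AlgebraicClosure k) c₀) * (μ * lam) := by
    rw [hφ, map_mul, map_C, geom_chartEquation, hFM, chartEquation_mul,
      chartEquation_linearForm _ _ _ _ hzv, mul_comm μ]
  -- Here `lam` is the equation of the line in the chart, so each component of `φ` is, up to the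
  -- constant `c₀`, `lam` times the component of `μ` one degree lower.
  have hcomp : ∀ i, map (algebraMap k (AlgebraicClosure k)) (homogeneousComponent (i + 1) φ) =
      C (algebraMap k (AlgebraicClosure k) c₀) * (homogeneousComponent i μ * lam) := by
    intro i
    rw [map_homogeneousComponent, hφμ, homogeneousComponent_C_mul,
      homogeneousComponent_mul_of_isHomogeneous hlam1]
  rcases htype with ⟨hm, hlow, l, hl, hass, hprod⟩ | ⟨-, -, L, ⟨hL1, hL0⟩, hL2, -, -⟩
  -- For `m - 1 ≠ n`, the component of `μ` of degree `m - 1` vanishes in the direction of the line,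
  -- so `lam ^ 2` divides a product of distinct linear forms.
  · have hmn : m = n + 1 := by
      by_contra hne
      obtain ⟨i, rfl⟩ : ∃ i, m = i + 1 := ⟨m - 1, by omega⟩
      have h0 := eval_homogeneousComponent_chartEquation hM (geomPoint v) (geomPoint u)
        (geomPoint w) α β hnz (i := i) (by omega)
      have hd := dvd_of_eval_eq_zero hαβ (homogeneousComponent_isHomogeneous i μ) h0
      have hlamne : lam ≠ 0 := by
        intro h
        rcases hαβ with h' | h'
        · apply h'
          have := congrArg (eval ![1, 0]) h
          simpa [hlam] using this
        · apply h'
          have := congrArg (eval ![0, 1]) h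
          simpa [hlam] using this
      refine not_dvd_of_prod_eq hl hass (irreducible_of_isHomogeneous_one hlam1 hlamne)
        (η := C (algebraMap k (AlgebraicClosure k) c₀) * homogeneousComponent i μ) ?_
        (hd.mul_left _)
      rw [← hprod, hcomp]
      ring
    subst hmn
    have hφF : chartEquation (geom F) (geomPoint v) (geomPoint u) (geomPoint w) =
        C (algebraMap k (AlgebraicClosure k) c₀)⁻¹ * map (algebraMap k (AlgebraicClosure k)) φ := by
      rw [hφ, map_mul, map_C, geom_chartEquation, ← mul_assoc, ← C_mul,
        inv_mul_cancel₀ ((map_ne_zero _).mpr hc₀), C_1, one_mul]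
    have hFhom : (geom F).IsHomogeneous (n + 1) := hF.map _
    have hhom : (chartEquation (geom F) (geomPoint v) (geomPoint u) (geomPoint w)).IsHomogeneous
        (n + 1) := by
      refine isHomogeneous_of_homogeneousComponent_eq_zero (totalDegree_chartEquation_le hFhom _ _ _)
        fun i hi => ?_
      rw [hφF, homogeneousComponent_C_mul, ← map_homogeneousComponent, hlow i hi, map_zero, mul_zero]
    have hinf : Infinite (AlgebraicClosure k) := IsAlgClosed.instInfinite
    obtain ⟨c₁, zB, zC, -, hcone⟩ := exists_eq_aeval_of_isHomogeneous_chartEquation hFhom hD hhom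
    have hφl : map (algebraMap k (AlgebraicClosure k)) φ = ∏ j, l j := by
      rw [← hprod, map_homogeneousComponent]
      refine (homogeneousComponent_eq_self ?_).symm
      have : map (algebraMap k (AlgebraicClosure k)) φ = C (algebraMap k (AlgebraicClosure k) c₀) *
          chartEquation (geom F) (geomPoint v) (geomPoint u) (geomPoint w) := by
        rw [hφ, map_mul, map_C, geom_chartEquation]
      rw [this]
      exact hhom.C_mul _
    refine ⟨c₁ * (algebraMap k (AlgebraicClosure k) c₀)⁻¹,
      fun j => aeval ![linearForm zB, linearForm zC] (l j), fun j => ?_, ?_⟩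
    · have := (hl j).1.aeval ![linearForm zB, linearForm zC] (n := 1) (fun i => by
        fin_cases i
        · exact isHomogeneous_linearForm zB
        · exact isHomogeneous_linearForm zC)
      rwa [one_mul] at this
    · rw [hcone, hφF, hφl, map_mul, map_prod, C_mul, algHom_C, algebraMap_eq, mul_assoc]
  · exfalso
    let a := coeff (Finsupp.single 0 1) L
    let b := coeff (Finsupp.single 1 1) L
    have hL : L = C a * X 0 + C b * X 1 := by
      have h : L ∈ homogeneousSubmodule (Fin 2) k 1 := hL1
      rw [homogeneousSubmodule_one_eq_span_X, Submodule.mem_span_range_iff_exists_fun] at h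
      obtain ⟨c, hcL⟩ := h
      simp only [a, b]
      rw [← hcL]
      simp [Fin.sum_univ_two, smul_eq_C_mul, coeff_X, Finsupp.single_left_inj]
    have hab : a ≠ 0 ∨ b ≠ 0 := by
      by_contra! h
      apply hL0
      rw [hL, h.1, h.2]
      simp
    -- `L ^ 2` is divisible by `lam`, so `L` vanishes in the direction of the line, and `b u - a w`
    -- is a second rational point on it.
    have hrel : algebraMap k (AlgebraicClosure k) a * β - algebraMap k (AlgebraicClosure k) b * α = 0 := by
      have h1 := congrArg (eval ![β, -α]) (hcomp 1)
      rw [hL2, map_pow, map_pow, map_mul, map_mul, hlam0, mul_zero, mul_zero] at h1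
      have h2 := pow_eq_zero_iff (two_ne_zero) |>.mp h1
      rw [hL] at h2
      simp at h2
      linear_combination h2
    refine hline (containsLine_of_crossProduct_ne_zero hz hdvd (v := v)
      (crossProduct_frame_ne_zero hDk hab) hzv ?_)
    have h1 : geomPoint (b • u - a • w) = algebraMap k (AlgebraicClosure k) b • geomPoint u -
        algebraMap k (AlgebraicClosure k) a • geomPoint w := by
      ext j
      simp [geomPoint, Algebra.smul_def]
    rw [h1, hev, dotProduct_sub, dotProduct_smul, dotProduct_smul, ← hev, ← hev, ← hα, ← hβ,
      smul_eq_mul, smul_eq_mul]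
    linear_combination - hrel

end LineComponent

/-! ### Homogeneous factors and the numerical cases -/

theorem exists_isHomogeneous_factor {σ K : Type*} [Field K] {A N : MvPolynomial σ K} {a n : ℕ}
    (hA : A.IsHomogeneous a) (h : (A * N).IsHomogeneous (n + a)) :
    ∃ N', N'.IsHomogeneous n ∧ A * N = A * N' := by
  refine ⟨homogeneousComponent n N, homogeneousComponent_isHomogeneous n N, ?_⟩
  have h1 := homogeneousComponent_mul_of_isHomogeneous hA N n
  rw [mul_comm N, homogeneousComponent_eq_self h] at h1
  rw [h1, mul_comm]

theorem exists_eq_mul_of_not_irreducible {σ K : Type*} [Field K] {H : MvPolynomial σ K}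
    (hH : H.IsHomogeneous 2) (h0 : H ≠ 0) (hirr : ¬ Irreducible H) :
    ∃ A B : MvPolynomial σ K, A.IsHomogeneous 1 ∧ B.IsHomogeneous 1 ∧ H = A * B := by
  have hu : ¬ IsUnit H := by
    intro hu
    have h2 : constantCoeff H = 0 := hH.coeff_eq_zero (by simp)
    exact not_isUnit_zero (h2 ▸ hu.map constantCoeff)
  rw [irreducible_iff] at hirr
  push Not at hirr
  obtain ⟨A, B, hAB, hA, hB⟩ := hirr hu
  have hA0 : A ≠ 0 := fun h => h0 (by rw [hAB, h, zero_mul])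
  have hB0 : B ≠ 0 := fun h => h0 (by rw [hAB, h, mul_zero])
  have hdeg := hH.totalDegree h0
  rw [hAB, totalDegree_mul_of_isDomain hA0 hB0] at hdeg
  have hpos : ∀ P : MvPolynomial σ K, P ≠ 0 → ¬ IsUnit P → P.totalDegree ≠ 0 := by
    intro P hP hPu hP'
    rw [totalDegree_eq_zero_iff_eq_C] at hP'
    rw [hP'] at hP hPu
    exact hPu ((isUnit_iff_ne_zero.mpr fun h => hP (by rw [h, C_0])).map C)
  have hA1 := hpos A hA0 hA
  have hB1 := hpos B hB0 hB
  refine ⟨homogeneousComponent 1 A, homogeneousComponent 1 B,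
    homogeneousComponent_isHomogeneous _ _, homogeneousComponent_isHomogeneous _ _, ?_⟩
  -- The factors have total degree one but may have constant terms; only their linear parts
  -- contribute to the component of degree two.
  have hAsum : A = homogeneousComponent 0 A + homogeneousComponent 1 A := by
    conv_lhs => rw [← sum_homogeneousComponent A, (by omega : A.totalDegree = 1)]
    simp [Finset.sum_range_succ]
  have h2 : homogeneousComponent 2 (A * B) = homogeneousComponent 1 B * homogeneousComponent 1 A := by
    conv_lhs => rw [hAsum, add_mul, map_add, homogeneousComponent_zero, homogeneousComponent_C_mul,
      homogeneousComponent_eq_zero 2 B (by omega), mul_zero, zero_add, mul_comm]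
    exact homogeneousComponent_mul_of_isHomogeneous (homogeneousComponent_isHomogeneous 1 A) B 1
  rw [mul_comm, ← h2, ← hAB, homogeneousComponent_eq_self hH]

/-- For `f = 6, 7, 8, 9` the genus bound reads `d ≤ 6, 11, 14, 17`. The first products out of reach
are `2·4`, `3·4`, `3·5` and `3·6`. For `f ≤ 5` no splitting is possible. -/
theorem degrees_of_caseOfInterest {f a b d : ℕ} (hcase : CaseOfInterest f (((f - 1).choose 2 : ℤ) - d))
    (hab : a + b = f) (hle : a ≤ b) (ha : 0 < a) (hd : a * b ≤ d) :
    a = 1 ∧ 6 ≤ f ∨ a = 2 ∧ 7 ≤ f := by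
  have hf : f ≤ 9 := by
    rcases hcase with h | h | h <;> omega
  have ha4 : a ≤ 4 := by omega
  unfold CaseOfInterest at hcase
  subst hab
  have hb : b ≤ 9 := by omega
  interval_cases a <;> interval_cases b <;> simp [Nat.choose] at hcase hf hle hd ⊢ <;> omega

/-! ### Linear and quadratic factors -/

section Main

variable {k : Type u} [Field k]

theorem map_algEquiv_geom (F : MvPolynomial (Fin 3) k)
    (s : AlgebraicClosure k ≃ₐ[k] AlgebraicClosure k) :
    map (s : AlgebraicClosure k →+* AlgebraicClosure k) (geom F) = geom F := by
  rw [geom, map_map]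
  congr 2
  ext x
  simp

theorem mul_le_of_geom_eq_mul {F : MvPolynomial (Fin 3) k} {f d : ℕ} (hF : F.IsHomogeneous f)
    (h0 : F ≠ 0) (hd : totalDelta (geom F) = d) {a b : ℕ}
    {H H' : MvPolynomial (Fin 3) (AlgebraicClosure k)} (hH : H.IsHomogeneous a)
    (hH' : H'.IsHomogeneous b) (h : geom F = H * H') : a + b = f ∧ a * b ≤ d := by
  have h0' : geom F ≠ 0 := (map_ne_zero_iff _ geom_injective).mpr h0
  constructor
  · exact (h ▸ hH.mul hH').inj_right (hF.map _) h0'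
  · have := mul_le_totalDelta hH hH' (h ▸ h0')
    rw [← h, hd] at this
    exact_mod_cast this

theorem containsLine_of_linear_factor {F : MvPolynomial (Fin 3) k} {f d : ℕ}
    (hF : F.IsHomogeneous f) (h0 : F ≠ 0) (hadm : HasOnlyAdmissibleSingularities F)
    (hd : totalDelta (geom F) = d) (hcase : CaseOfInterest f (((f - 1).choose 2 : ℤ) - d))
    {A M : MvPolynomial (Fin 3) (AlgebraicClosure k)} {n : ℕ} (hA : A.IsHomogeneous 1)
    (hM : M.IsHomogeneous n) (hn : 0 < n) (h : geom F = A * M) : ContainsLine F := by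
  have h0' : geom F ≠ 0 := (map_ne_zero_iff _ geom_injective).mpr h0
  obtain ⟨hnf, hnd⟩ := mul_le_of_geom_eq_mul hF h0 hd hA hM h
  have hf6 : 6 ≤ f := by
    have := degrees_of_caseOfInterest hcase hnf hn one_pos hnd
    omega
  obtain ⟨z, rfl⟩ := exists_eq_linearForm hA
  have hz : z ≠ 0 := by
    rintro rfl
    apply h0'
    rw [h]
    simp [linearForm]
  obtain ⟨r, rfl⟩ : ∃ r, n = r + 2 := ⟨n - 2, by omega⟩
  rw [← hnf, add_comm] at hF
  refine (containsLine_or_cone hF hn hadm hz hM h).resolve_right ?_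
  rintro ⟨c, l, hl, hcone⟩
  -- Three lines of the cone form a cubic factor with cofactor of degree `f - 3 ≥ 3`, which the
  -- numerical bound excludes.
  rw [Fin.prod_univ_succ, Fin.prod_univ_succ, Fin.prod_univ_succ] at hcone
  rw [show C c * (l 0 * (l (Fin.succ 0) * (l (Fin.succ (Fin.succ 0)) *
    ∏ i : Fin r, l i.succ.succ.succ))) = (C c * (l 0 * (l (Fin.succ 0) * l (Fin.succ (Fin.succ 0))))) *
    ∏ i : Fin r, l i.succ.succ.succ by ring] at hcone
  have h3 : (C c * (l 0 * (l (Fin.succ 0) * l (Fin.succ (Fin.succ 0))))).IsHomogeneous 3 :=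
    ((hl _).mul ((hl _).mul (hl _))).C_mul c
  have hr : (∏ i : Fin r, l i.succ.succ.succ).IsHomogeneous r := by
    have := IsHomogeneous.prod Finset.univ (fun i : Fin r => l i.succ.succ.succ) (fun _ => 1)
      fun i _ => hl _
    simpa using this
  obtain ⟨h1, h2⟩ := mul_le_of_geom_eq_mul hF h0 hd h3 hr hcone
  have := degrees_of_caseOfInterest hcase (a := 3) (b := r) (by omega) (by omega) (by omega) h2
  omega

theorem containsIrreducibleConic_of_irreducible_factor {F : MvPolynomial (Fin 3) k} {f d : ℕ}
    (hF : F.IsHomogeneous f) (h0 : F ≠ 0) (hd : totalDelta (geom F) = d)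
    (hcase : CaseOfInterest f (((f - 1).choose 2 : ℤ) - d)) (hf : 7 ≤ f)
    {H M : MvPolynomial (Fin 3) (AlgebraicClosure k)} {n : ℕ} (hH : H.IsHomogeneous 2)
    (hM : M.IsHomogeneous n) (hirr : Irreducible H) (h : geom F = H * M) :
    ContainsIrreducibleConic F := by
  have h0' : geom F ≠ 0 := (map_ne_zero_iff _ geom_injective).mpr h0
  obtain ⟨hnf, hnd⟩ := mul_le_of_geom_eq_mul hF h0 hd hH hM h
  have hndvd : ¬ H ∣ M := not_sq_dvd_of_totalDelta_ne_top hH hM (h ▸ h0')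
    (by rw [← h, hd]; exact ENat.natCast_ne_top d) two_pos
  obtain ⟨d₀, hd₀⟩ := ne_zero_iff.mp hirr.ne_zero
  -- With one coefficient equal to `1`, a conjugate proportional to `Q` equals `Q`.
  obtain ⟨Q, hQ⟩ : ∃ Q, Q = C (coeff d₀ H)⁻¹ * H := ⟨_, rfl⟩
  have hunit : IsUnit (C (coeff d₀ H)⁻¹ : MvPolynomial (Fin 3) (AlgebraicClosure k)) :=
    (isUnit_iff_ne_zero.mpr (inv_ne_zero hd₀)).map C
  have hassoc : Associated H Q := by
    rw [hQ]
    exact (associated_unit_mul_left H _ hunit).symm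
  have hQirr : Irreducible Q := hassoc.irreducible hirr
  have hQ2 : Q.IsHomogeneous 2 := hQ ▸ hH.C_mul _
  have hQ1 : coeff d₀ Q = 1 := by rw [hQ, coeff_C_mul, inv_mul_cancel₀ hd₀]
  have hFQ : geom F = Q * (C (coeff d₀ H) * M) := by
    rw [h, hQ]
    have : (C (coeff d₀ H)⁻¹ * C (coeff d₀ H) : MvPolynomial (Fin 3) (AlgebraicClosure k)) = 1 := by
      rw [← C_mul, inv_mul_cancel₀ hd₀, C_1]
    linear_combination - H * M * this
  have hM' : (C (coeff d₀ H) * M).IsHomogeneous n := hM.C_mul _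
  have hQM : ¬ Q ∣ C (coeff d₀ H) * M := by
    rw [← hassoc.dvd_iff_dvd_left, ((isUnit_iff_ne_zero.mpr hd₀).map C).dvd_mul_left]
    exact hndvd
  rcases exists_map_eq_or_exists_conjugate_ne hQirr hQ2 hQ1 hFQ hQM with ⟨G, hG⟩ | ⟨s, hs⟩
  · have hGQ : geom G = Q := hG
    refine ⟨G, IsHomogeneous.of_map (algebraMap k (AlgebraicClosure k)).injective (hG ▸ hQ2),
      hGQ ▸ hQirr, dvd_of_geom_dvd ?_ (hGQ ▸ ⟨_, hFQ⟩)⟩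
    rintro rfl
    exact hQirr.ne_zero (hG.symm.trans (map_zero _))
  · exfalso
    set Q' := map (s : AlgebraicClosure k →+* AlgebraicClosure k) Q with hQ'
    have hQ'2 : Q'.IsHomogeneous 2 := hQ2.map _
    have hQ'irr : Irreducible Q' :=
      (MulEquiv.irreducible_iff (mapEquiv (Fin 3) s.toRingEquiv)).mpr hQirr
    have hQ'1 : coeff d₀ Q' = 1 := by rw [hQ', coeff_map, hQ1, map_one]
    have hdvd : Q' ∣ Q * (C (coeff d₀ H) * M) := by
      rw [← hFQ, ← map_algEquiv_geom F s]
      exact map_dvd _ ⟨_, hFQ⟩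
    rcases hQ'irr.prime.dvd_or_dvd hdvd with ⟨c, hc⟩ | ⟨N, hN⟩
    · have hc0 : c ≠ 0 := by
        rintro rfl
        exact hQirr.ne_zero (by rw [hc, mul_zero])
      have h1 := congrArg totalDegree hc
      rw [totalDegree_mul_of_isDomain hQ'irr.ne_zero hc0, hQ2.totalDegree hQirr.ne_zero,
        hQ'2.totalDegree hQ'irr.ne_zero] at h1
      rw [totalDegree_eq_zero_iff_eq_C.mp (by omega : c.totalDegree = 0)] at hc
      have h2 := congrArg (coeff d₀) hc
      rw [mul_comm, coeff_C_mul, hQ'1, hQ1, mul_one] at h2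
      rw [← h2, C_1, mul_one] at hc
      exact hs hc.symm
    -- The conjugate divides the cofactor, so `Q * Q'` is a quartic factor with cofactor of degree
    -- `r = f - 4 ≥ 3`: both degrees exceed `2`.
    · obtain ⟨r, rfl⟩ : ∃ r, n = r + 2 := ⟨n - 2, by omega⟩
      obtain ⟨N', hN', hNN'⟩ := exists_isHomogeneous_factor hQ'2 (hN ▸ hM')
      have hF4 : geom F = (Q * Q') * N' := by rw [hFQ, hN, hNN', mul_assoc]
      obtain ⟨h1, h2⟩ := mul_le_of_geom_eq_mul hF h0 hd (hQ2.mul hQ'2) hN' hF4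
      rcases le_total 4 r with hr | hr
      · have := degrees_of_caseOfInterest hcase (a := 4) (b := r) (by omega) hr (by omega) h2
        omega
      · have := degrees_of_caseOfInterest hcase (a := r) (b := 4) (by omega) hr (by omega)
          (by rw [mul_comm]; exact h2)
        omega

end Main

end PlaneCurve

open PlaneCurve in
theorem mainTheorem4 {k : Type*} [Field k] (F : MvPolynomial (Fin 3) k) (f : ℕ) (g : ℤ)
    (hF : F.IsHomogeneous f) (hred : Squarefree F)
    (hadm : PlaneCurve.HasOnlyAdmissibleSingularities F)
    (hg : PlaneCurve.HasGenus F f g) (hcase : PlaneCurve.CaseOfInterest f g)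
    (hsplit : PlaneCurve.IsReducibleCurve F) :
    PlaneCurve.ContainsLine F ∨ PlaneCurve.ContainsIrreducibleConic F := by
  obtain ⟨d, hd, rfl⟩ := hg
  have h0 : F ≠ 0 := hred.ne_zero
  have main : ∀ (a b : ℕ) (H K : MvPolynomial (Fin 3) (AlgebraicClosure k)), 0 < a → a ≤ b →
      H.IsHomogeneous a → K.IsHomogeneous b → geom F = H * K →
      ContainsLine F ∨ ContainsIrreducibleConic F := by
    intro a b H K ha hab hH hK h
    obtain ⟨h1, h2⟩ := mul_le_of_geom_eq_mul hF h0 hd hH hK h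
    rcases degrees_of_caseOfInterest hcase h1 hab ha h2 with ⟨rfl, -⟩ | ⟨rfl, hf⟩
    · exact Or.inl (containsLine_of_linear_factor hF h0 hadm hd hcase hH hK (by omega) h)
    · by_cases hirr : Irreducible H
      · exact Or.inr (containsIrreducibleConic_of_irreducible_factor hF h0 hd hcase hf hH hK hirr h)
      -- A reducible conic splits into two lines, one of which serves as a linear factor of `F`.
      · have hH0 : H ≠ 0 := by
          rintro rfl
          rw [zero_mul] at h
          exact h0 (geom_injective (h.trans (map_zero _).symm))
        obtain ⟨A, B, hA, hB, rfl⟩ := exists_eq_mul_of_not_irreducible hH hH0 hirr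
        exact Or.inl (containsLine_of_linear_factor hF h0 hadm hd hcase hA (hB.mul hK) (by omega)
          (h.trans (mul_assoc _ _ _)))
  obtain ⟨a, b, H, K, ha, hb, hH, hK, h⟩ := hsplit
  rcases le_total a b with hab | hab
  · exact main a b H K ha hab hH hK h
  · exact main b a K H hb hab hK hH (h.trans (mul_comm _ _))
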